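/- Let $(X_t)_{t\ge 0}$ be a one-dimensional Lévy process started from $0$ under a probability measure $\mathbb{P}$ (independent and stationary increments, càdlàg paths), with characteristic exponent $\varPsi$, i.e. $\mathbb{P}[\mathrm{e}^{\mathrm{i}\lambda X_t}]=\mathrm{e}^{-t\varPsi(\lambda)}$ for all $t\ge 0$ and $\lambda\in\mathbb{R}$ (here $\mathbb{P}[\,\cdot\,]$ also denotes expectation). Assume that $X$ is recurrent, i.e. $$\mathbb{P}\Big[\int_0^\infty 1_{\{|X_t-a|<\varepsilon\}}\,\mathrm{d}t\Big]=\infty\qquad\text{for all } a\in\mathbb{R},\ \varepsilon>0,$$ and that the following condition holds: (A) for each $q>0$, $\displaystyle\int_0^\infty\Big|\frac{1}{q+\varPsi(\lambda)}\Big|\,\mathrm{d}\lambda<\infty$. Then for every $q>0$ there is a unique bounded continuous $q$-resolvent density $r_q\ge 0$, i.e. a bounded continuous function with $\int_{\mathbb{R}}f(x)r_q(x)\,\mathrm{d}x=\mathbb{P}\big[\int_0^\infty \mathrm{e}^{-qt}f(X_t)\,\mathrm{d}t\big]$ for all non-negative measurable $f$. Put $h_q(x)=r_q(0)-r_q(-x)$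 for $x\in\mathbb{R}$ and $m^2=\mathbb{P}[X_1^2]\in(0,\infty]$. The following assertions hold. 1. For every $x\in\mathbb{R}$ the limit $h(x):=\lim_{q\to 0+}h_q(x)$ exists and is finite. If $m^2<\infty$, then for every $x\in\mathbb{R}$ $$h(x)=\frac1\pi\int_0^\infty \operatorname{Re}\Big(\frac{1-\mathrm{e}^{\mathrm{i}\lambda x}}{\varPsi(\lambda)}\Big)\,\mathrm{d}\lambda,$$ where the integral converges absolutely. 2. The convergence $h_q\to h$ as $q\to 0+$ is uniform on compact subsets of $\mathbb{R}$, and consequently $h$ is continuous. 3. $h$ is subadditive on $\mathbb{R}$: $h(x+y)\le h(x)+h(y)$ for all $x,y\in\mathbb{R}$. -/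

import Mathlib

open MeasureTheory ProbabilityTheory Filter Topology Set
open scoped NNReal ENNReal

noncomputable section

/-- A real-valued Lévy process started from `0`, indexed by `[0, ∞)`: it has independent and
stationary increments, starts from `0` almost surely and has càdlàg paths. -/
structure IsLevyProcess {Ω : Type*} [MeasurableSpace Ω] (X : ℝ≥0 → Ω → ℝ) (P : Measure Ω) :
    Prop where
  measurable : ∀ t, Measurable (X t)
  start_zero : ∀ᵐ ω ∂P, X 0 ω = 0
  indep_increments : HasIndepIncrements X P
  stationary_increments : ∀ s t, IdentDistrib (X (s + t) - X s) (X t) P P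
  right_continuous : ∀ ω t, ContinuousWithinAt (fun s => X s ω) (Ici t) t
  left_limits : ∀ ω t, ∃ l : ℝ, Tendsto (fun s => X s ω) (𝓝[<] t) (𝓝 l)

/-- The characteristic exponent `Ψ`: `Ψ(lam)` is the complex number `ψ` with
`E[exp(i lam X_t)] = exp(-t ψ)` for all `t ≥ 0`. For a Lévy process it exists
(`IsLevyProcess.integral_exp_eq`) and it is unique (`IsLevyProcess.eq_charExponent`). -/
def charExponent {Ω : Type*} [MeasurableSpace Ω] (X : ℝ≥0 → Ω → ℝ) (P : Measure Ω)
    (lam : ℝ) : ℂ :=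
  Classical.epsilon fun ψ : ℂ => ∀ t : ℝ≥0,
    ∫ ω, Complex.exp (Complex.I * lam * X t ω) ∂P = Complex.exp (-(t : ℝ) * ψ)

/-- Recurrence: the expected time spent in every open interval is infinite. -/
def IsRecurrentProcess {Ω : Type*} [MeasurableSpace Ω] (X : ℝ≥0 → Ω → ℝ) (P : Measure Ω) :
    Prop :=
  ∀ a ε : ℝ, 0 < ε →
    ∫⁻ ω, ∫⁻ t in Ici (0 : ℝ),
      {y : ℝ | |y - a| < ε}.indicator (fun _ => (1 : ℝ≥0∞)) (X t.toNNReal ω) ∂volume ∂P = ∞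

/-- Condition (A): `∫_0^∞ |1 / (q + Ψ(lam))| d lam < ∞` for every `q > 0`. -/
def ConditionA {Ω : Type*} [MeasurableSpace Ω] (X : ℝ≥0 → Ω → ℝ) (P : Measure Ω) : Prop :=
  ∀ q : ℝ, 0 < q →
    ∫⁻ lam in Ioi (0 : ℝ), ‖1 / ((q : ℂ) + charExponent X P lam)‖ₑ < ∞

/-- `r` is the bounded continuous `q`-resolvent density of `X`:
`∫ f(x) r(x) dx = E[∫_0^∞ exp(-q t) f(X_t) dt]` for all non-negative measurable `f`. -/
structure IsResolventDensity {Ω : Type*} [MeasurableSpace Ω] (X : ℝ≥0 → Ω → ℝ) (P : Measure Ω)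
    (q : ℝ) (r : ℝ → ℝ) : Prop where
  continuous : Continuous r
  nonneg : ∀ x, 0 ≤ r x
  bounded : ∃ C, ∀ x, r x ≤ C
  lintegral_eq : ∀ f : ℝ → ℝ≥0∞, Measurable f →
    ∫⁻ x, f x * ENNReal.ofReal (r x) =
      ∫⁻ ω, ∫⁻ t in Ici (0 : ℝ),
        ENNReal.ofReal (Real.exp (-q * t)) * f (X t.toNNReal ω) ∂volume ∂P

/-- The bounded continuous `q`-resolvent density `r_q`. It is unique when it exists
(`IsResolventDensity.eq`). -/
def resolventDensity {Ω : Type*} [MeasurableSpace Ω] (X : ℝ≥0 → Ω → ℝ) (P : Measure Ω)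
    (q : ℝ) : ℝ → ℝ :=
  Classical.epsilon (IsResolventDensity X P q)

/-- `h_q(x) = r_q(0) - r_q(-x)`. -/
def hq {Ω : Type*} [MeasurableSpace Ω] (X : ℝ≥0 → Ω → ℝ) (P : Measure Ω) (q x : ℝ) : ℝ :=
  resolventDensity X P q 0 - resolventDensity X P q (-x)

/-- The second moment `m² = E[X_1²]`, possibly infinite. -/
def secondMoment {Ω : Type*} [MeasurableSpace Ω] (X : ℝ≥0 → Ω → ℝ) (P : Measure Ω) : ℝ≥0∞ :=
  ∫⁻ ω, ENNReal.ofReal (X 1 ω ^ 2) ∂P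

/-! Well-definedness of the two objects that are defined by a characterizing property. -/

theorem exists_exp_of_mul_semigroup (f : ℝ≥0 → ℂ) (h0 : f 0 = 1)
    (hadd : ∀ s t, f (s + t) = f s * f t) (hle : ∀ t, ‖f t‖ ≤ 1)
    (hc : ContinuousAt f 0) : ∃ ψ : ℂ, ∀ t : ℝ≥0, f t = Complex.exp (-(t : ℝ) * ψ) := by
  have key : ∀ s t : ℝ≥0, s ≤ t → dist (f s) (f t) ≤ dist (f (t - s)) 1 := by
    intro s t hst
    have : f t = f s * f (t - s) := by rw [← hadd, add_tsub_cancel_of_le hst]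
    rw [this, dist_comm, dist_eq_norm, dist_eq_norm,
      show f s * f (t - s) - f s = f s * (f (t - s) - 1) by ring, norm_mul]
    exact mul_le_of_le_one_left (norm_nonneg _) (hle s)
  have hcont : Continuous f := by
    rw [Metric.continuous_iff]
    intro b ε hε
    obtain ⟨δ, hδ, H⟩ := Metric.continuousAt_iff.1 hc ε hε
    refine ⟨δ, hδ, fun a hab => ?_⟩
    rcases le_total a b with h | h
    · refine (key a b h).trans_lt ?_
      rw [← h0]
      apply H
      rw [NNReal.dist_eq] at hab ⊢
      rw [NNReal.coe_sub h]
      simpa [abs_sub_comm] using hab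
    · rw [dist_comm]
      refine (key b a h).trans_lt ?_
      rw [← h0]
      apply H
      rw [NNReal.dist_eq] at hab ⊢
      rw [NNReal.coe_sub h]
      simpa using hab
  set g : ℝ → ℂ := fun t => f t.toNNReal with hg
  have hgc : Continuous g := hcont.comp continuous_real_toNNReal
  have hgadd : ∀ s t : ℝ, 0 ≤ s → 0 ≤ t → g (s + t) = g s * g t := by
    intro s t hs ht
    simp only [hg]
    rw [Real.toNNReal_add hs ht, hadd]
  have hg0 : g 0 = 1 := by simp [hg, h0]
  set G : ℝ → ℂ := fun t => ∫ s in (0 : ℝ)..t, g s with hG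
  have hGd : ∀ t, HasDerivAt G (g t) t := fun t =>
    intervalIntegral.integral_hasDerivAt_right (hgc.intervalIntegrable _ _)
      (hgc.stronglyMeasurableAtFilter _ _) hgc.continuousAt
  have hGa : ∃ a > 0, G a ≠ 0 := by
    have h1 : ∀ᶠ t in 𝓝[≠] (0 : ℝ), G t ≠ G 0 :=
      (hGd 0).eventually_ne (by rw [hg0]; exact one_ne_zero)
    have h2 : ∀ᶠ t in 𝓝[>] (0 : ℝ), G t ≠ G 0 :=
      h1.filter_mono (nhdsWithin_mono _ fun x hx => ne_of_gt hx)
    obtain ⟨a, ha, ha'⟩ := (h2.and self_mem_nhdsWithin).exists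
    exact ⟨a, ha', by simpa [hG] using ha⟩
  obtain ⟨a, ha, hGa⟩ := hGa
  have hrep : ∀ t : ℝ, 0 ≤ t → g t * G a = G (t + a) - G t := by
    intro t ht
    have e1 : G (t + a) - G t = ∫ s in t..(t + a), g s :=
      intervalIntegral.integral_interval_sub_left (hgc.intervalIntegrable _ _)
        (hgc.intervalIntegrable _ _)
    have e2 : ∫ s in (0 : ℝ)..a, g (t + s) = ∫ s in t..(t + a), g s := by
      simp
    rw [e1, ← e2, hG]
    simp only
    rw [← intervalIntegral.integral_const_mul]
    refine intervalIntegral.integral_congr fun s hs => ?_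
    rw [uIcc_of_le ha.le] at hs
    exact (hgadd t s ht hs.1).symm
  set c : ℂ := (g a - 1) / G a with hcdef
  have hgd : ∀ t : ℝ, 0 ≤ t → HasDerivWithinAt g (c * g t) (Ici t) t := by
    intro t ht
    have h1 : HasDerivAt (fun u => (G (u + a) - G u) / G a) ((g (t + a) - g t) / G a) t :=
      (((hGd (t + a)).comp_add_const t a).sub (hGd t)).div_const _
    have h2 : (g (t + a) - g t) / G a = c * g t := by
      rw [hgadd t a ht ha.le, hcdef]; ring
    have h3 : ∀ u, 0 ≤ u → g u = (G (u + a) - G u) / G a := by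
      intro u hu
      rw [← hrep u hu, mul_div_assoc, div_self hGa, mul_one]
    rw [h2] at h1
    exact h1.hasDerivWithinAt.congr (fun u hu => h3 u (ht.trans hu)) (h3 t ht)
  have hE : ∀ x : ℝ, HasDerivAt (fun x : ℝ => Complex.exp (-(c * x)))
      (Complex.exp (-(c * x)) * -(c * 1)) x := fun x =>
    (((Complex.ofRealCLM.hasDerivAt (x := x)).const_mul c).neg).cexp
  refine ⟨-c, fun t => ?_⟩
  have hconst := constant_of_has_deriv_right_zero (a := 0) (b := (t : ℝ))
    (f := fun x : ℝ => g x * Complex.exp (-(c * x)))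
    (by fun_prop)
    (fun x hx => by
      have := (hgd x hx.1).mul (hE x).hasDerivWithinAt
      convert! this using 1
      ring)
    t ⟨t.2, le_rfl⟩
  simp only [hg0, Complex.ofReal_zero, mul_zero, neg_zero, Complex.exp_zero, mul_one] at hconst
  have hgt : g t = f t := by simp [hg]
  rw [hgt, Complex.exp_neg] at hconst
  rw [mul_inv_eq_one₀ (Complex.exp_ne_zero _)] at hconst
  rw [hconst]
  congr 1
  ring

theorem IsLevyProcess.exists_exponent {Ω : Type*} [MeasurableSpace Ω] {X : ℝ≥0 → Ω → ℝ}
    {P : Measure Ω} [IsProbabilityMeasure P] (hX : IsLevyProcess X P) (lam : ℝ) :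
    ∃ ψ : ℂ, ∀ t : ℝ≥0,
      ∫ ω, Complex.exp (Complex.I * lam * X t ω) ∂P = Complex.exp (-(t : ℝ) * ψ) := by
  have hmeas := hX.measurable
  have hch : ∀ t, ∫ ω, Complex.exp (Complex.I * lam * X t ω) ∂P = charFun (P.map (X t)) lam := by
    intro t
    rw [charFun_apply_real, integral_map (hmeas t).aemeasurable (by fun_prop)]
    refine integral_congr_ae (.of_forall fun ω => ?_)
    simp only
    congr 1
    ring
  have hnorm : ∀ (t : ℝ≥0) ω, ‖Complex.exp (Complex.I * lam * X t ω)‖ ≤ 1 := by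
    intro t ω
    rw [Complex.norm_exp]
    simp
  refine exists_exp_of_mul_semigroup _ ?_ ?_ ?_ ?_
  · rw [integral_congr_ae (g := fun _ => (1 : ℂ))]
    · simp
    · filter_upwards [hX.start_zero] with ω hω
      simp [hω]
  · intro s t
    rw [hch, hch, hch]
    have hind := hX.indep_increments.indepFun_eval_sub (r := 0) (s := s) (t := s + t)
      (zero_le) (le_self_add) hX.start_zero
    have := hind.charFun_map_add_eq_mul (hmeas s).aemeasurable
      ((hmeas (s + t)).sub (hmeas s)).aemeasurable
    rw [add_sub_cancel, (hX.stationary_increments s t).map_eq] at this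
    rw [this]
    rfl
  · intro t
    refine (norm_integral_le_of_norm_le_const (.of_forall (hnorm t))).trans ?_
    simp
  · refine continuousAt_of_dominated (bound := fun _ => 1) (.of_forall fun t => ?_)
      (.of_forall fun t => .of_forall (hnorm t)) (integrable_const _) (.of_forall fun ω => ?_)
    · have := hmeas t
      exact Measurable.aestronglyMeasurable (by fun_prop)
    · have h1 : ContinuousAt (fun s => X s ω) 0 := by
        have := hX.right_continuous ω 0
        rwa [show Ici (0 : ℝ≥0) = univ from Ici_bot, continuousWithinAt_univ] at this
      fun_prop

theorem IsLevyProcess.integral_exp_eq {Ω : Type*} [MeasurableSpace Ω] {X : ℝ≥0 → Ω → ℝ}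
    {P : Measure Ω} [IsProbabilityMeasure P] (hX : IsLevyProcess X P) (lam : ℝ) (t : ℝ≥0) :
    ∫ ω, Complex.exp (Complex.I * lam * X t ω) ∂P =
      Complex.exp (-(t : ℝ) * charExponent X P lam) :=
  Classical.epsilon_spec (hX.exists_exponent lam) t

theorem IsLevyProcess.eq_charExponent {Ω : Type*} [MeasurableSpace Ω] {X : ℝ≥0 → Ω → ℝ}
    {P : Measure Ω} [IsProbabilityMeasure P] (hX : IsLevyProcess X P) (lam : ℝ) (ψ : ℂ)
    (hψ : ∀ t : ℝ≥0,
      ∫ ω, Complex.exp (Complex.I * lam * X t ω) ∂P = Complex.exp (-(t : ℝ) * ψ)) :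
    ψ = charExponent X P lam := by
  have hd : ∀ z : ℂ, HasDerivWithinAt (fun t : ℝ => Complex.exp (-(t : ℂ) * z)) (-z)
      (Ici 0) 0 := by
    intro z
    have := (((Complex.ofRealCLM.hasDerivAt (x := (0 : ℝ))).neg.mul_const z).cexp)
    simpa using this.hasDerivWithinAt
  have h2 := (hd ψ).congr (f₁ := fun t : ℝ => Complex.exp (-(t : ℂ) * charExponent X P lam))
    (fun t ht => by
      have h3 := (hX.integral_exp_eq lam ⟨t, ht⟩).symm.trans (hψ ⟨t, ht⟩)
      exact h3) (by simp)
  have := (uniqueDiffWithinAt_Ici (0 : ℝ)).eq_deriv _ h2 (hd _)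
  exact neg_injective this

theorem IsResolventDensity.eq {Ω : Type*} [MeasurableSpace Ω] {X : ℝ≥0 → Ω → ℝ}
    {P : Measure Ω} {q : ℝ} {r r' : ℝ → ℝ} (hr : IsResolventDensity X P q r)
    (hr' : IsResolventDensity X P q r') : r = r' := by
  have hm : Measurable fun x => ENNReal.ofReal (r x) := hr.continuous.measurable.ennreal_ofReal
  have hm' : Measurable fun x => ENNReal.ofReal (r' x) :=
    hr'.continuous.measurable.ennreal_ofReal
  have h1 : (fun x => ENNReal.ofReal (r x)) =ᵐ[volume] fun x => ENNReal.ofReal (r' x) := by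
    refine ae_eq_of_forall_setLIntegral_eq_of_sigmaFinite hm hm' fun s hs _ => ?_
    have e := (hr.lintegral_eq (s.indicator 1) (measurable_one.indicator hs)).trans
      (hr'.lintegral_eq (s.indicator 1) (measurable_one.indicator hs)).symm
    rw [← lintegral_indicator hs, ← lintegral_indicator hs]
    convert! e using 2 with x x
    all_goals
      ext x
      by_cases hx : x ∈ s <;> simp [hx]
  refine (hr.continuous.ae_eq_iff_eq (μ := volume) hr'.continuous).1 ?_
  filter_upwards [h1] with x hx
  exact (ENNReal.ofReal_eq_ofReal_iff (hr.nonneg x) (hr'.nonneg x)).1 hx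

end

/-! The `q`-resolvent measure has characteristic function `1/(q+Ψ)`, integrable by (A), so Fourier
inversion gives it a continuous density `r_q`. Everything about `h_q` then rests on two facts that
hold uniformly in `q`.

Positivity and subadditivity. The resolvent equation yields a maximum principle for potentials and,
by shrinking an interval to a point, `r_q(x) r_q(y) ≤ r_q(0) r_q(x+y)` (`mul_le`). Hence `0 ≤ h_q`
and `h_q(x+y) ≤ h_q(x) + h_q(y)`, and the latter survives the limit.

Equicontinuity. The symmetrization `h_q(x) + h_q(-x)` involves only `(1 - cos λx) Re 1/(q+Ψ)`, so it
is at most `ω(x) = (1/π) ∫ (1 - cos λx)/|Ψ(λ)| dλ` (`symmMajorant`), which tends to `0` at `0`.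
Subadditivity turns this into `|h_q(x) - h_q(y)| ≤ ω(x-y)`. So limits along subsequences exist, and
pointwise convergence is automatically uniform on compacts. It remains to identify the limit,
according to whether `∫ x² r_1(x) dx` is finite.

Infinite case. Any subsequential limit solves `H(x) = h_1(x) + ∫ r_1(y) (H(x+y) - H(y)) dy`. The
increments of the difference `g` of two solutions are bounded and harmonic for `r_1`, hence constant
by Choquet–Deny, so `g` is additive. Since `|Ψ(λ)|/λ² → ∞` at `0`, `ω(x) = o(|x|)` at infinity,
which forces `g = 0` (`IsSubseqLimit.eq`).

Finite case. Recurrence makes `r_q(0)` unbounded, which forces `∫ x r_1(x) dx = 0`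
(`first_moment_eq_zero`). Then `Im Ψ` is so small near `0` that the inversion integral for `h_q` is
dominated uniformly in `q` (`exists_bound`), and the limit is the stated integral. If `m² < ∞`, this
case applies (`integrable_sq_mul`). -/

/-! ### Fourier inversion for finite measures on the line. -/

theorem exists_contDiff_tendsto_indicator_Ioo (a b : ℝ) :
    ∃ f : ℕ → ℝ → ℝ, (∀ n, ContDiff ℝ (⊤ : ℕ∞) (f n)) ∧ (∀ n, HasCompactSupport (f n)) ∧
      (∀ n x, f n x = (Icc a b).indicator (f n) x) ∧ (∀ n x, f n x ∈ Icc (0 : ℝ) 1) ∧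
      ∀ x, Tendsto (fun n => f n x) atTop (𝓝 ((Ioo a b).indicator (fun _ => (1 : ℝ)) x)) := by
  -- Two smooth ramps, one at each endpoint, steepening with `n`. Both vanish at their endpoint, so
  -- the limit is the indicator of the open interval.
  set f : ℕ → ℝ → ℝ := fun n x =>
    Real.smoothTransition (n * (x - a)) * Real.smoothTransition (n * (b - x)) with hf
  have h0 : ∀ n x, x ∉ Ioo a b → f n x = 0 := by
    intro n x hx
    rw [mem_Ioo, not_and_or, not_lt, not_lt] at hx
    rcases hx with h | h
    · simp only [hf]
      rw [Real.smoothTransition.zero_of_nonpos (x := n * (x - a)), zero_mul]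
      exact mul_nonpos_of_nonneg_of_nonpos (by positivity) (by linarith)
    · simp only [hf]
      rw [Real.smoothTransition.zero_of_nonpos (x := n * (b - x)), mul_zero]
      exact mul_nonpos_of_nonneg_of_nonpos (by positivity) (by linarith)
  refine ⟨f, fun n => ?_, fun n => ?_, fun n x => ?_, fun n x => ?_, fun x => ?_⟩
  · have h1 : ContDiff ℝ (⊤ : ℕ∞) Real.smoothTransition := Real.smoothTransition.contDiff
    exact (h1.comp (by fun_prop)).mul (h1.comp (by fun_prop))
  · exact HasCompactSupport.intro (isCompact_Icc (a := a) (b := b))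
      fun x hx => h0 n x fun h => hx (Ioo_subset_Icc_self h)
  · by_cases hx : x ∈ Icc a b
    · rw [indicator_of_mem hx]
    · rw [indicator_of_notMem hx]
      exact h0 n x fun h => hx (Ioo_subset_Icc_self h)
  · exact ⟨mul_nonneg (Real.smoothTransition.nonneg _) (Real.smoothTransition.nonneg _),
      mul_le_one₀ (Real.smoothTransition.le_one _) (Real.smoothTransition.nonneg _)
        (Real.smoothTransition.le_one _)⟩
  · by_cases hx : x ∈ Ioo a b
    · rw [indicator_of_mem hx]
      have h1 : ∀ c : ℝ, 0 < c → ∀ᶠ n : ℕ in atTop, Real.smoothTransition (n * c) = 1 := by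
        intro c hc
        have : Tendsto (fun n : ℕ => (n : ℝ) * c) atTop atTop :=
          tendsto_natCast_atTop_atTop.atTop_mul_const hc
        filter_upwards [this.eventually_ge_atTop 1] with n hn
        exact Real.smoothTransition.one_of_one_le hn
      refine tendsto_const_nhds.congr' ?_
      filter_upwards [h1 (x - a) (sub_pos.2 hx.1), h1 (b - x) (sub_pos.2 hx.2)] with n h1 h2
      simp [hf, h1, h2]
    · rw [indicator_of_notMem hx]
      simp only [h0 _ x hx]
      exact tendsto_const_nhds

/-- A finite measure which integrates smooth compactly supported functions like the continuous
function `ρ` has density `ρ`. -/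
theorem eq_withDensity_of_integral_contDiff {μ : Measure ℝ} [IsFiniteMeasure μ] {ρ : ℝ → ℝ}
    (hρ : Continuous ρ)
    (h : ∀ f : ℝ → ℝ, ContDiff ℝ (⊤ : ℕ∞) f → HasCompactSupport f →
      ∫ x, f x ∂μ = ∫ x, f x * ρ x) :
    (∀ x, 0 ≤ ρ x) ∧ μ = volume.withDensity fun x => ENNReal.ofReal (ρ x) := by
  have key : ∀ a b : ℝ, μ.real (Ioo a b) = ∫ x in Ioo a b, ρ x := by
    intro a b
    obtain ⟨f, hf1, hf2, hf3, hf4, hf5⟩ := exists_contDiff_tendsto_indicator_Ioo a b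
    have t1 : Tendsto (fun n => ∫ x, f n x ∂μ) atTop
        (𝓝 (∫ x, (Ioo a b).indicator (fun _ => (1 : ℝ)) x ∂μ)) := by
      refine tendsto_integral_of_dominated_convergence (fun _ => 1)
        (fun n => (hf1 n).continuous.aestronglyMeasurable) (integrable_const _)
        (fun n => .of_forall fun x => ?_) (.of_forall hf5)
      rw [Real.norm_eq_abs, abs_of_nonneg (hf4 n x).1]
      exact (hf4 n x).2
    have t2 : Tendsto (fun n => ∫ x, f n x * ρ x) atTop
        (𝓝 (∫ x, (Ioo a b).indicator (fun _ => (1 : ℝ)) x * ρ x)) := by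
      refine tendsto_integral_of_dominated_convergence ((Icc a b).indicator fun x => |ρ x|)
        (fun n => ((hf1 n).continuous.mul hρ).aestronglyMeasurable) ?_
        (fun n => .of_forall fun x => ?_) (.of_forall fun x => (hf5 x).mul_const _)
      · rw [integrable_indicator_iff measurableSet_Icc]
        exact hρ.abs.continuousOn.integrableOn_compact isCompact_Icc
      · rw [hf3 n x]
        by_cases hx : x ∈ Icc a b
        · rw [indicator_of_mem hx, indicator_of_mem hx, norm_mul, Real.norm_eq_abs,
            Real.norm_eq_abs, abs_of_nonneg (hf4 n x).1]
          exact mul_le_of_le_one_left (abs_nonneg _) (hf4 n x).2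
        · simp [hx]
    have t3 := tendsto_nhds_unique (t1.congr fun n => h _ (hf1 n) (hf2 n)) t2
    rw [integral_indicator measurableSet_Ioo] at t3
    simp only [integral_const, smul_eq_mul, mul_one, measureReal_restrict_apply_univ] at t3
    rw [t3, ← integral_indicator measurableSet_Ioo]
    refine integral_congr_ae (.of_forall fun x => ?_)
    by_cases hx : x ∈ Ioo a b <;> simp [hx]
  have hnn : ∀ x, 0 ≤ ρ x := by
    intro x
    by_contra! hx
    obtain ⟨ε, hε, H⟩ := Metric.continuousAt_iff.1 hρ.continuousAt (-ρ x / 2) (by linarith)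
    have h1 : ∫ y in Ioo (x - ε) (x + ε), ρ y ≤ ∫ y in Ioo (x - ε) (x + ε), ρ x / 2 := by
      refine setIntegral_mono_on ?_ ?_ measurableSet_Ioo fun y hy => ?_
      · exact (hρ.continuousOn.integrableOn_compact (isCompact_Icc)).mono_set Ioo_subset_Icc_self
      · exact integrableOn_const (by simp)
      · have := H (x := y) (by rw [Real.dist_eq, abs_lt]; constructor <;> linarith [hy.1, hy.2])
        rw [Real.dist_eq, abs_lt] at this
        linarith [this.2]
    rw [← key, setIntegral_const] at h1
    have h2 : volume.real (Ioo (x - ε) (x + ε)) = 2 * ε := by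
      rw [Real.volume_real_Ioo_of_le (by linarith)]; ring
    rw [h2, smul_eq_mul] at h1
    have := measureReal_nonneg (μ := μ) (s := Ioo (x - ε) (x + ε))
    nlinarith
  refine ⟨hnn, ?_⟩
  refine Real.measure_ext_Ioo_rat fun a b => ?_
  rw [withDensity_apply _ measurableSet_Ioo, ← ofReal_integral_eq_lintegral_ofReal, ← key,
    ofReal_measureReal]
  · exact (hρ.continuousOn.integrableOn_compact (isCompact_Icc)).mono_set Ioo_subset_Icc_self
  · exact .of_forall hnn

theorem continuous_integral_exp_mul_re {φ : ℝ → ℂ} (hφ : Integrable φ) :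
    Continuous fun x : ℝ => ∫ l : ℝ, (Complex.exp (-(Complex.I * l * x)) * φ l).re := by
  refine continuous_of_dominated (bound := fun l => ‖φ l‖) (fun x => ?_)
    (fun x => .of_forall fun l => ?_) hφ.norm (.of_forall fun l => by fun_prop)
  · exact Complex.continuous_re.comp_aestronglyMeasurable
      (AEStronglyMeasurable.mul (by fun_prop) hφ.1)
  · refine (Complex.abs_re_le_norm _).trans ?_
    rw [norm_mul, Complex.norm_exp]
    simp

-- Parseval's identity: expand `f` by Fourier inversion inside `∫ f dμ`, apply Fubini, and expand
-- back. The substitution `l = 2πξ` produces the factor `1/(2π)`; taking real parts loses nothing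
-- because the left side is real.
open FourierTransform in
theorem integral_contDiff_eq_integral_charFun {μ : Measure ℝ} [IsFiniteMeasure μ]
    (hint : Integrable (charFun μ)) {f : ℝ → ℝ} (hf : ContDiff ℝ (⊤ : ℕ∞) f)
    (hc : HasCompactSupport f) :
    ∫ x, f x ∂μ = ∫ x : ℝ, f x * ((1 / (2 * Real.pi)) *
      ∫ l : ℝ, (Complex.exp (-(Complex.I * l * x)) * charFun μ l).re) := by
  have hF : ContDiff ℝ (⊤ : ℕ∞) fun x => (f x : ℂ) := Complex.ofRealCLM.contDiff.comp hf
  have hFc : HasCompactSupport fun x => (f x : ℂ) := hc.comp_left Complex.ofReal_zero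
  set S : SchwartzMap ℝ ℂ := hFc.toSchwartzMap hF with hS
  have hSf : ∀ x, S x = (f x : ℂ) := fun x => rfl
  set T : SchwartzMap ℝ ℂ := 𝓕 S with hT
  have hTi : Integrable T := T.integrable
  have hinv : ∀ x : ℝ, (f x : ℂ) =
      ∫ ξ : ℝ, Complex.exp (2 * Real.pi * ξ * x * Complex.I) * T ξ := by
    intro x
    have h1 : 𝓕⁻ (𝓕 (S : ℝ → ℂ)) x = S x :=
      MeasureTheory.Integrable.fourierInv_fourier_eq S.integrable
        (by rw [← SchwartzMap.fourier_coe]; exact T.integrable) S.continuous.continuousAt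
    rw [← hSf, ← h1, Real.fourierInv_eq', ← SchwartzMap.fourier_coe]
    refine integral_congr_ae (.of_forall fun ξ => ?_)
    simp only [smul_eq_mul, hT]
    congr 2
    simp
    ring
  have hfour : ∀ l : ℝ, T (l / (2 * Real.pi)) =
      ∫ y : ℝ, Complex.exp (-(Complex.I * l * y)) * f y := by
    intro l
    rw [hT, SchwartzMap.fourier_coe, Real.fourier_eq']
    refine integral_congr_ae (.of_forall fun ξ => ?_)
    simp only [smul_eq_mul, hSf]
    congr 2
    have : (Real.pi : ℂ) ≠ 0 := by exact_mod_cast Real.pi_ne_zero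
    simp
    field_simp
  have e1 : ∫ x, (f x : ℂ) ∂μ = ∫ ξ : ℝ, T ξ * charFun μ (2 * Real.pi * ξ) := by
    simp_rw [hinv]
    rw [integral_integral_swap]
    · refine integral_congr_ae (.of_forall fun ξ => ?_)
      simp only
      rw [charFun_apply_real, integral_mul_const, mul_comm]
      congr 1
      refine integral_congr_ae (.of_forall fun x => ?_)
      simp
    · have h1 : Integrable (fun z : ℝ × ℝ => (1 : ℂ) * T z.2) (μ.prod volume) :=
        (integrable_const (1 : ℂ)).mul_prod hTi
      simp only [one_mul] at h1
      refine h1.bdd_mul (c := 1) (by fun_prop) (.of_forall fun z => ?_)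
      rw [Complex.norm_exp]
      simp
  have hpi : (2 * Real.pi) ≠ 0 := by positivity
  have e2 : ∫ ξ : ℝ, T ξ * charFun μ (2 * Real.pi * ξ) =
      ((1 / (2 * Real.pi) : ℝ) : ℂ) * ∫ l : ℝ, T (l / (2 * Real.pi)) * charFun μ l := by
    have := Measure.integral_comp_mul_left
      (fun l : ℝ => T (l / (2 * Real.pi)) * charFun μ l) (2 * Real.pi)
    simp only [mul_div_cancel_left₀ _ hpi] at this
    rw [this, abs_of_pos (by positivity), Complex.real_smul, one_div]
  have hfi : Integrable fun y => (f y : ℂ) := S.integrable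
  have hprod : Integrable (fun z : ℝ × ℝ =>
      Complex.exp (-(Complex.I * z.1 * z.2)) * (charFun μ z.1 * f z.2)) (volume.prod volume) := by
    refine (hint.mul_prod hfi).bdd_mul (c := 1) (by fun_prop) (.of_forall fun z => ?_)
    rw [Complex.norm_exp]
    simp
  have e3 : ∫ l : ℝ, T (l / (2 * Real.pi)) * charFun μ l =
      ∫ y : ℝ, (f y : ℂ) * ∫ l : ℝ, Complex.exp (-(Complex.I * l * y)) * charFun μ l := by
    simp_rw [hfour]
    calc _ = ∫ l : ℝ, ∫ y : ℝ, Complex.exp (-(Complex.I * l * y)) * (charFun μ l * f y) := by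
          refine integral_congr_ae (.of_forall fun l => ?_)
          simp only
          rw [← integral_mul_const]
          refine integral_congr_ae (.of_forall fun y => ?_)
          simp only
          ring
      _ = ∫ y : ℝ, ∫ l : ℝ, Complex.exp (-(Complex.I * l * y)) * (charFun μ l * f y) :=
          integral_integral_swap hprod
      _ = _ := by
          refine integral_congr_ae (.of_forall fun y => ?_)
          simp only
          rw [← integral_const_mul]
          refine integral_congr_ae (.of_forall fun l => ?_)
          simp only
          ring
  have hphase : ∀ y : ℝ,
      Integrable fun l : ℝ => Complex.exp (-(Complex.I * l * y)) * charFun μ l := by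
    intro y
    refine hint.bdd_mul (c := 1) (by fun_prop) (.of_forall fun z => ?_)
    rw [Complex.norm_exp]
    simp
  have hI : Integrable fun y : ℝ =>
      (f y : ℂ) * ∫ l : ℝ, Complex.exp (-(Complex.I * l * y)) * charFun μ l := by
    refine (hprod.integral_prod_right).congr (.of_forall fun y => ?_)
    simp only
    rw [← integral_const_mul]
    refine integral_congr_ae (.of_forall fun l => ?_)
    simp only
    ring
  have e4 : ((∫ x, f x ∂μ : ℝ) : ℂ) = ((1 / (2 * Real.pi) : ℝ) : ℂ) *
      ∫ y : ℝ, (f y : ℂ) * ∫ l : ℝ, Complex.exp (-(Complex.I * l * y)) * charFun μ l := by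
    rw [← integral_complex_ofReal, e1, e2, e3]
  have e5 := congrArg Complex.re e4
  rw [Complex.ofReal_re, Complex.re_ofReal_mul] at e5
  have e6 : (∫ y : ℝ, (f y : ℂ) * ∫ l : ℝ, Complex.exp (-(Complex.I * l * y)) * charFun μ l).re
      = ∫ y : ℝ, ((f y : ℂ) * ∫ l : ℝ, Complex.exp (-(Complex.I * l * y)) * charFun μ l).re :=
    (integral_re hI).symm
  rw [e5, e6, ← integral_const_mul]
  refine integral_congr_ae (.of_forall fun y => ?_)
  have e7 : (∫ l : ℝ, Complex.exp (-(Complex.I * l * y)) * charFun μ l).re =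
      ∫ l : ℝ, (Complex.exp (-(Complex.I * l * y)) * charFun μ l).re :=
    (integral_re (hphase y)).symm
  simp only [Complex.re_ofReal_mul]
  rw [e7]
  ring

theorem eq_withDensity_of_integrable_charFun {μ : Measure ℝ} [IsFiniteMeasure μ]
    (hint : Integrable (charFun μ)) :
    (∀ x : ℝ, 0 ≤ (1 / (2 * Real.pi)) *
      ∫ l : ℝ, (Complex.exp (-(Complex.I * l * x)) * charFun μ l).re) ∧
    μ = volume.withDensity fun x : ℝ => ENNReal.ofReal ((1 / (2 * Real.pi)) *
      ∫ l : ℝ, (Complex.exp (-(Complex.I * l * x)) * charFun μ l).re) :=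
  eq_withDensity_of_integral_contDiff ((continuous_integral_exp_mul_re hint).const_mul _)
    fun _ hf hc => integral_contDiff_eq_integral_charFun hint hf hc

/-- Integrability on the half line of a function with even norm gives integrability. -/
theorem MeasureTheory.IntegrableOn.integrable_of_norm_even {E : Type*}
    [NormedAddCommGroup E] {f : ℝ → E}
    (hf : IntegrableOn f (Ioi 0)) (hm : AEStronglyMeasurable f)
    (heven : ∀ x, ‖f (-x)‖ = ‖f x‖) : Integrable f := by
  have h1 : IntegrableOn (fun x => ‖f x‖) (Ioi 0) := hf.norm
  have h2 : IntegrableOn (fun x => ‖f x‖) (Iic 0) := by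
    rw [← Measure.map_neg_eq_self (volume : Measure ℝ)]
    let m : MeasurableEmbedding fun x : ℝ => -x := (Homeomorph.neg ℝ).measurableEmbedding
    rw [m.integrableOn_map_iff]
    simp_rw [Function.comp_def, heven, neg_preimage, neg_Iic, neg_zero]
    exact (integrableOn_Ici_iff_integrableOn_Ioi (by simp)).2 h1
  have h3 := h2.union h1
  rw [Iic_union_Ioi, integrableOn_univ] at h3
  exact (integrable_norm_iff hm).1 h3

/-- Nonnegative integrable functions `r q`, `q > 0`, whose Fourier transforms are
`1 / (q + Ψ)`. -/
structure IsResolventFamily (Ψ : ℝ → ℂ) (r : ℝ → ℝ → ℝ) : Prop where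
  continuous_exponent : Continuous Ψ
  exponent_zero : Ψ 0 = 0
  re_nonneg : ∀ l, 0 ≤ (Ψ l).re
  exponent_neg : ∀ l, Ψ (-l) = (starRingEnd ℂ) (Ψ l)
  integrable_inv : ∀ q : ℝ, 0 < q → Integrable fun l => ((q : ℂ) + Ψ l)⁻¹
  nonneg : ∀ q : ℝ, 0 < q → ∀ x, 0 ≤ r q x
  integrable : ∀ q : ℝ, 0 < q → Integrable (r q)
  fourier : ∀ q : ℝ, 0 < q → ∀ l : ℝ,
    ∫ y : ℝ, Complex.exp (Complex.I * l * y) * r q y = ((q : ℂ) + Ψ l)⁻¹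
  inversion : ∀ q : ℝ, 0 < q → ∀ x : ℝ, r q x = (1 / (2 * Real.pi)) *
    ∫ l : ℝ, (Complex.exp (-(Complex.I * l * x)) * ((q : ℂ) + Ψ l)⁻¹).re

/-! ### The resolvent measure of the process and its density. -/

section Levy

variable {Ω : Type*} [MeasurableSpace Ω] {X : ℝ≥0 → Ω → ℝ} {P : Measure Ω}

/-- Joint measurability is needed for Fubini. Time is approximated by grid points that decrease to
it; the `+ 1` after the floor keeps them on the right, where the paths are continuous. -/
theorem IsLevyProcess.measurable_uncurry (hX : IsLevyProcess X P) :
    Measurable fun z : Ω × ℝ => X z.2.toNNReal z.1 := by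
  have key : ∀ z : Ω × ℝ, Tendsto
      (fun n : ℕ => X ((⌊((n : ℝ≥0) + 1) * z.2.toNNReal⌋₊ + 1 : ℕ) / ((n : ℝ≥0) + 1)) z.1)
      atTop (𝓝 (X z.2.toNNReal z.1)) := by
    rintro ⟨ω, s⟩
    set t := s.toNNReal
    have h1 := (hX.right_continuous ω t).tendsto
    refine h1.comp (tendsto_nhdsWithin_iff.2 ⟨?_, .of_forall fun n => ?_⟩)
    · have hup : ∀ n : ℕ, ((⌊((n : ℝ≥0) + 1) * t⌋₊ + 1 : ℕ) : ℝ≥0) / ((n : ℝ≥0) + 1) ≤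
          t + 1 / ((n : ℝ≥0) + 1) := by
        intro n
        have hn : (0 : ℝ≥0) < (n : ℝ≥0) + 1 := by positivity
        rw [div_le_iff₀ hn, add_mul t, one_div, inv_mul_cancel₀ hn.ne']
        push_cast
        gcongr
        rw [mul_comm t]
        exact Nat.floor_le zero_le
      have hlo : ∀ n : ℕ, t ≤ ((⌊((n : ℝ≥0) + 1) * t⌋₊ + 1 : ℕ) : ℝ≥0) / ((n : ℝ≥0) + 1) := by
        intro n
        have hn : (0 : ℝ≥0) < (n : ℝ≥0) + 1 := by positivity
        rw [le_div_iff₀ hn, mul_comm]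
        push_cast
        exact (Nat.lt_floor_add_one _).le
      refine tendsto_of_tendsto_of_tendsto_of_le_of_le tendsto_const_nhds ?_ hlo hup
      have : Tendsto (fun n : ℕ => 1 / ((n : ℝ≥0) + 1)) atTop (𝓝 0) :=
        tendsto_one_div_add_atTop_nhds_zero_nat
      simpa using this.const_add t
    · have hn : (0 : ℝ≥0) < (n : ℝ≥0) + 1 := by positivity
      rw [mem_Ici, le_div_iff₀ hn, mul_comm]
      push_cast
      exact (Nat.lt_floor_add_one _).le
  refine measurable_of_tendsto_metrizable (fun n => ?_) (tendsto_pi_nhds.2 key)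
  have h1 : Measurable fun p : Ω × ℕ => X ((p.2 + 1 : ℕ) / ((n : ℝ≥0) + 1)) p.1 :=
    measurable_from_prod_countable_left
      fun k => hX.measurable (((k + 1 : ℕ) : ℝ≥0) / ((n : ℝ≥0) + 1))
  have h2 : Measurable fun z : Ω × ℝ => (z.1, ⌊((n : ℝ≥0) + 1) * z.2.toNNReal⌋₊) :=
    measurable_fst.prodMk (Nat.measurable_floor.comp (by fun_prop))
  exact h1.comp h2

/-- The law of exponentially discounted time, `exp (-q t) dt` on `[0, ∞)`. -/
noncomputable def discountMeasure (q : ℝ) : Measure ℝ :=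
  (volume.restrict (Ici (0 : ℝ))).withDensity fun t => ENNReal.ofReal (Real.exp (-q * t))

theorem isFiniteMeasure_discountMeasure {q : ℝ} (hq : 0 < q) :
    IsFiniteMeasure (discountMeasure q) := by
  have h1 : IntegrableOn (fun x : ℝ => Real.exp (-q * x)) (Ici 0) :=
    (integrableOn_Ici_iff_integrableOn_Ioi (by simp)).2 (integrableOn_exp_mul_Ioi (by linarith) 0)
  exact isFiniteMeasure_withDensity_ofReal h1.2

instance (q : ℝ) : SFinite (discountMeasure q) := by
  unfold discountMeasure
  infer_instance

/-- The `q`-resolvent measure of the process. -/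
noncomputable def resolventMeasure (X : ℝ≥0 → Ω → ℝ) (P : Measure Ω) (q : ℝ) : Measure ℝ :=
  (P.prod (discountMeasure q)).map fun z : Ω × ℝ => X z.2.toNNReal z.1

theorem lintegral_resolventMeasure [IsProbabilityMeasure P] (hX : IsLevyProcess X P) (q : ℝ)
    {f : ℝ → ℝ≥0∞} (hf : Measurable f) :
    ∫⁻ x, f x ∂resolventMeasure X P q = ∫⁻ ω, ∫⁻ t in Ici (0 : ℝ),
      ENNReal.ofReal (Real.exp (-q * t)) * f (X t.toNNReal ω) ∂volume ∂P := by
  have hm := hX.measurable_uncurry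
  rw [resolventMeasure, lintegral_map hf hm,
    lintegral_prod (fun z : Ω × ℝ => f (X z.2.toNNReal z.1)) (hf.comp hm).aemeasurable]
  refine lintegral_congr fun ω => ?_
  have hω : Measurable fun t : ℝ => f (X t.toNNReal ω) :=
    hf.comp (hm.comp (measurable_const.prodMk measurable_id))
  exact lintegral_withDensity_eq_lintegral_mul _ (by fun_prop) hω

theorem isFiniteMeasure_resolventMeasure [IsProbabilityMeasure P] {q : ℝ} (hq : 0 < q) :
    IsFiniteMeasure (resolventMeasure X P q) := by
  have := isFiniteMeasure_discountMeasure hq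
  unfold resolventMeasure
  infer_instance

theorem IsLevyProcess.re_charExponent_nonneg [IsProbabilityMeasure P] (hX : IsLevyProcess X P)
    (l : ℝ) : 0 ≤ (charExponent X P l).re := by
  have h1 : ‖∫ ω, Complex.exp (Complex.I * l * X 1 ω) ∂P‖ ≤ 1 := by
    refine (norm_integral_le_of_norm_le_const (C := 1) (.of_forall fun ω => ?_)).trans (by simp)
    rw [Complex.norm_exp]
    simp
  rw [hX.integral_exp_eq l 1, Complex.norm_exp] at h1
  simpa using h1

theorem IsLevyProcess.charExponent_neg [IsProbabilityMeasure P] (hX : IsLevyProcess X P)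
    (l : ℝ) : charExponent X P (-l) = (starRingEnd ℂ) (charExponent X P l) := by
  refine (hX.eq_charExponent (-l) _ fun t => ?_).symm
  have h1 := congrArg (starRingEnd ℂ) (hX.integral_exp_eq l t)
  rw [← integral_conj, ← Complex.exp_conj] at h1
  simp only [← Complex.exp_conj, map_mul, map_neg, Complex.conj_ofReal, Complex.conj_I] at h1
  rw [← h1]
  refine integral_congr_ae (.of_forall fun ω => ?_)
  simp

theorem IsLevyProcess.add_charExponent_ne_zero [IsProbabilityMeasure P] (hX : IsLevyProcess X P)
    {q : ℝ} (hq : 0 < q) (l : ℝ) : (q : ℂ) + charExponent X P l ≠ 0 := by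
  intro h
  have h1 := congrArg Complex.re h
  have h2 := hX.re_charExponent_nonneg l
  simp at h1
  linarith

/-- Fubini reduces this to `∫_0^∞ exp(-(q+Ψ)t) dt`, which converges since `Re (q+Ψ) > 0`. -/
theorem IsLevyProcess.charFun_resolventMeasure [IsProbabilityMeasure P] (hX : IsLevyProcess X P)
    {q : ℝ} (hq : 0 < q) (l : ℝ) :
    charFun (resolventMeasure X P q) l = ((q : ℂ) + charExponent X P l)⁻¹ := by
  have hm := hX.measurable_uncurry
  have := isFiniteMeasure_discountMeasure hq
  rw [charFun_apply_real, resolventMeasure, integral_map hm.aemeasurable (by fun_prop),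
    integral_prod_symm]
  · have e1 : ∀ t : ℝ, 0 ≤ t → ∫ ω, Complex.exp (l * X t.toNNReal ω * Complex.I) ∂P =
        Complex.exp (-t * charExponent X P l) := by
      intro t ht
      have := hX.integral_exp_eq l t.toNNReal
      rw [Real.coe_toNNReal t ht] at this
      rw [← this]
      refine integral_congr_ae (.of_forall fun ω => ?_)
      simp only
      congr 1
      ring
    rw [discountMeasure, integral_withDensity_eq_integral_toReal_smul (by fun_prop)
      (.of_forall fun _ => ENNReal.ofReal_lt_top)]
    rw [integral_Ici_eq_integral_Ioi]
    rw [setIntegral_congr_fun (g := fun t : ℝ => Complex.exp (-((q : ℂ) + charExponent X P l) * t))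
      measurableSet_Ioi]
    · rw [integral_exp_mul_complex_Ioi]
      · rw [Complex.ofReal_zero, mul_zero, Complex.exp_zero, neg_div_neg_eq, one_div]
      · have := hX.re_charExponent_nonneg l
        simp
        linarith
    · intro t ht
      simp only
      rw [e1 t (le_of_lt ht), ENNReal.toReal_ofReal (Real.exp_pos _).le, Complex.real_smul,
        Complex.ofReal_exp, ← Complex.exp_add]
      congr 1
      push_cast
      ring
  · refine Integrable.of_bound (C := 1) (Continuous.comp_aestronglyMeasurable
      (g := fun x : ℝ => Complex.exp (l * x * Complex.I)) (by fun_prop) hm.aestronglyMeasurable)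
      (.of_forall fun z => ?_)
    rw [Complex.norm_exp]
    simp

/-- Inverting the formula for the resolvent at `q = 1` writes `Ψ` through a characteristic function
without zeros, which avoids choosing a branch of the logarithm. -/
theorem IsLevyProcess.continuous_charExponent [IsProbabilityMeasure P] (hX : IsLevyProcess X P) :
    Continuous (charExponent X P) := by
  have := isFiniteMeasure_resolventMeasure (X := X) (P := P) one_pos
  have h1 : Continuous (charFun (resolventMeasure X P 1)) := continuous_charFun
  have h2 : charExponent X P = fun l => (charFun (resolventMeasure X P 1) l)⁻¹ - 1 := by
    ext l
    rw [hX.charFun_resolventMeasure one_pos, inv_inv]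
    simp
  rw [h2]
  refine (h1.inv₀ fun l => ?_).sub continuous_const
  rw [hX.charFun_resolventMeasure one_pos]
  exact inv_ne_zero (hX.add_charExponent_ne_zero one_pos l)

theorem IsLevyProcess.integrable_inv [IsProbabilityMeasure P] (hX : IsLevyProcess X P)
    (hA : ConditionA X P) {q : ℝ} (hq : 0 < q) :
    Integrable fun l => ((q : ℂ) + charExponent X P l)⁻¹ := by
  have hc : Continuous fun l => ((q : ℂ) + charExponent X P l)⁻¹ :=
    (hX.continuous_charExponent.const_add _).inv₀ fun l => hX.add_charExponent_ne_zero hq l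
  refine IntegrableOn.integrable_of_norm_even ⟨hc.aestronglyMeasurable, ?_⟩
    hc.aestronglyMeasurable fun l => ?_
  · have := hA q hq
    simpa only [one_div] using! this
  · rw [hX.charExponent_neg, norm_inv, norm_inv]
    congr 1
    rw [← Complex.norm_conj]
    simp

/-- The inverse Fourier transform of `1 / (q + Ψ)`. -/
noncomputable def inverseResolvent (Ψ : ℝ → ℂ) (q x : ℝ) : ℝ :=
  (1 / (2 * Real.pi)) * ∫ l : ℝ, (Complex.exp (-(Complex.I * l * x)) * ((q : ℂ) + Ψ l)⁻¹).re

theorem abs_inverseResolvent_le {Ψ : ℝ → ℂ} {q : ℝ}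
    (h : Integrable fun l => ((q : ℂ) + Ψ l)⁻¹) (x : ℝ) :
    |inverseResolvent Ψ q x| ≤ (1 / (2 * Real.pi)) * ∫ l : ℝ, ‖((q : ℂ) + Ψ l)⁻¹‖ := by
  rw [inverseResolvent, abs_mul, abs_of_pos (a := 1 / (2 * Real.pi)) (by positivity)]
  gcongr
  rw [← Real.norm_eq_abs]
  refine norm_integral_le_of_norm_le h.norm (.of_forall fun l => ?_)
  refine (Complex.abs_re_le_norm _).trans ?_
  rw [norm_mul, Complex.norm_exp]
  simp

theorem IsLevyProcess.resolventMeasure_eq_withDensity [IsProbabilityMeasure P]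
    (hX : IsLevyProcess X P) (hA : ConditionA X P) {q : ℝ} (hq : 0 < q) :
    (∀ x, 0 ≤ inverseResolvent (charExponent X P) q x) ∧ resolventMeasure X P q =
      volume.withDensity fun x => ENNReal.ofReal (inverseResolvent (charExponent X P) q x) := by
  have := isFiniteMeasure_resolventMeasure (X := X) (P := P) hq
  have h1 : charFun (resolventMeasure X P q) = fun l => ((q : ℂ) + charExponent X P l)⁻¹ :=
    funext fun l => hX.charFun_resolventMeasure hq l
  have h2 := eq_withDensity_of_integrable_charFun (μ := resolventMeasure X P q)
    (by rw [h1]; exact hX.integrable_inv hA hq)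
  simp only [h1] at h2
  exact h2

theorem IsLevyProcess.isResolventDensity_inverseResolvent [IsProbabilityMeasure P]
    (hX : IsLevyProcess X P) (hA : ConditionA X P) {q : ℝ} (hq : 0 < q) :
    IsResolventDensity X P q (inverseResolvent (charExponent X P) q) := by
  obtain ⟨h1, h2⟩ := hX.resolventMeasure_eq_withDensity hA hq
  have hc : Continuous (inverseResolvent (charExponent X P) q) :=
    (continuous_integral_exp_mul_re (hX.integrable_inv hA hq)).const_mul _
  refine ⟨hc, h1, ⟨_, fun x => (le_abs_self _).trans
    (abs_inverseResolvent_le (hX.integrable_inv hA hq) x)⟩, fun f hf => ?_⟩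
  rw [← lintegral_resolventMeasure hX q hf, h2, lintegral_withDensity_eq_lintegral_mul _
    hc.measurable.ennreal_ofReal hf]
  refine lintegral_congr fun x => ?_
  rw [Pi.mul_apply, mul_comm]

theorem IsLevyProcess.resolventDensity_eq [IsProbabilityMeasure P]
    (hX : IsLevyProcess X P) (hA : ConditionA X P) {q : ℝ} (hq : 0 < q) :
    resolventDensity X P q = inverseResolvent (charExponent X P) q :=
  (Classical.epsilon_spec (p := IsResolventDensity X P q)
    ⟨_, hX.isResolventDensity_inverseResolvent hA hq⟩).eq
    (hX.isResolventDensity_inverseResolvent hA hq)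

/-- The analysis of `h_q` uses only this package; the process returns only for recurrence and for
the second moment of `X_1`. -/
theorem IsLevyProcess.isResolventFamily [IsProbabilityMeasure P]
    (hX : IsLevyProcess X P) (hA : ConditionA X P) :
    IsResolventFamily (charExponent X P) (inverseResolvent (charExponent X P)) where
  continuous_exponent := hX.continuous_charExponent
  exponent_zero := (hX.eq_charExponent 0 0 fun t => by simp).symm
  re_nonneg := hX.re_charExponent_nonneg
  exponent_neg := hX.charExponent_neg
  integrable_inv := fun q hq => hX.integrable_inv hA hq
  nonneg := fun q hq => (hX.resolventMeasure_eq_withDensity hA hq).1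
  integrable := fun q hq => by
    have := isFiniteMeasure_resolventMeasure (X := X) (P := P) hq
    have h := hX.isResolventDensity_inverseResolvent hA hq
    refine ⟨h.continuous.aestronglyMeasurable, ?_⟩
    rw [hasFiniteIntegral_iff_ofReal (.of_forall h.nonneg)]
    have h2 := congrArg (fun m => m univ) (hX.resolventMeasure_eq_withDensity hA hq).2
    simp only [withDensity_apply _ MeasurableSet.univ, Measure.restrict_univ] at h2
    rw [← h2]
    exact measure_lt_top _ _
  fourier := fun q hq l => by
    have h := hX.isResolventDensity_inverseResolvent hA hq
    rw [← hX.charFun_resolventMeasure hq, charFun_apply_real,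
      (hX.resolventMeasure_eq_withDensity hA hq).2, integral_withDensity_eq_integral_toReal_smul
        h.continuous.measurable.ennreal_ofReal (.of_forall fun _ => ENNReal.ofReal_lt_top)]
    refine integral_congr_ae (.of_forall fun y => ?_)
    simp only
    rw [ENNReal.toReal_ofReal (h.nonneg y), Complex.real_smul, mul_comm]
    congr 2
    ring
  inversion := fun q _ x => rfl

end Levy

/-! ### The resolvent equation and the maximum principle. -/

namespace IsResolventFamily

variable {Ψ : ℝ → ℂ} {r : ℝ → ℝ → ℝ}

theorem add_ne_zero (hR : IsResolventFamily Ψ r) {q : ℝ} (hq : 0 < q) (l : ℝ) :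
    (q : ℂ) + Ψ l ≠ 0 := by
  intro h
  have h1 := congrArg Complex.re h
  have h2 := hR.re_nonneg l
  simp at h1
  linarith

theorem continuous (hR : IsResolventFamily Ψ r) {q : ℝ} (hq : 0 < q) : Continuous (r q) := by
  rw [funext (hR.inversion q hq)]
  exact (continuous_integral_exp_mul_re (hR.integrable_inv q hq)).const_mul _

theorem exists_le (hR : IsResolventFamily Ψ r) {q : ℝ} (hq : 0 < q) :
    ∃ C, 0 ≤ C ∧ ∀ x, r q x ≤ C := by
  refine ⟨_, (abs_nonneg _).trans (abs_inverseResolvent_le (hR.integrable_inv q hq) 0),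
    fun x => ?_⟩
  rw [hR.inversion q hq]
  exact (le_abs_self _).trans (abs_inverseResolvent_le (hR.integrable_inv q hq) x)

theorem integral_eq (hR : IsResolventFamily Ψ r) {q : ℝ} (hq : 0 < q) : ∫ y, r q y = q⁻¹ := by
  have h := hR.fourier q hq 0
  rw [hR.exponent_zero] at h
  simp only [Complex.ofReal_zero, mul_zero, zero_mul, Complex.exp_zero, one_mul, add_zero] at h
  rw [integral_complex_ofReal] at h
  exact_mod_cast h

theorem integrable_phase (hR : IsResolventFamily Ψ r) {q : ℝ} (hq : 0 < q) (x : ℝ) :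
    Integrable fun l : ℝ => Complex.exp (-(Complex.I * l * x)) * ((q : ℂ) + Ψ l)⁻¹ := by
  refine (hR.integrable_inv q hq).bdd_mul (c := 1) (by fun_prop) (.of_forall fun l => ?_)
  rw [Complex.norm_exp]
  simp

theorem integrable_phase_re (hR : IsResolventFamily Ψ r) {q : ℝ} (hq : 0 < q) (x : ℝ) :
    Integrable fun l : ℝ => (Complex.exp (-(Complex.I * l * x)) * ((q : ℂ) + Ψ l)⁻¹).re :=
  (hR.integrable_phase hq x).re

/-- Only `r q` is expanded by inversion; Fubini then leaves the Fourier transform of `r p` under the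
integral. -/
theorem integral_conv (hR : IsResolventFamily Ψ r) {p q : ℝ} (hp : 0 < p) (hq : 0 < q) (x : ℝ) :
    ∫ y, r p y * r q (x - y) = (1 / (2 * Real.pi)) * ∫ l : ℝ,
      (Complex.exp (-(Complex.I * l * x)) * (((p : ℂ) + Ψ l)⁻¹ * ((q : ℂ) + Ψ l)⁻¹)).re := by
  have hrp : Integrable fun y => (r p y : ℂ) := (hR.integrable p hp).ofReal
  have hA : Integrable (fun z : ℝ × ℝ => Complex.exp (-(Complex.I * z.2 * (x - z.1 : ℝ))) *
      ((r p z.1 : ℂ) * ((q : ℂ) + Ψ z.2)⁻¹)) (volume.prod volume) := by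
    refine (hrp.mul_prod (hR.integrable_inv q hq)).bdd_mul (c := 1)
      (by fun_prop) (.of_forall fun z => ?_)
    rw [Complex.norm_exp]
    simp
  calc ∫ y, r p y * r q (x - y)
      = ∫ y, (1 / (2 * Real.pi)) * ∫ l : ℝ, (Complex.exp (-(Complex.I * l * (x - y : ℝ))) *
          ((r p y : ℂ) * ((q : ℂ) + Ψ l)⁻¹)).re := by
        refine integral_congr_ae (.of_forall fun y => ?_)
        simp only
        rw [hR.inversion q hq (x - y), mul_left_comm, ← integral_const_mul (r p y)]
        congr 1
        refine integral_congr_ae (.of_forall fun l => ?_)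
        simp only
        rw [← Complex.re_ofReal_mul, mul_left_comm]
    _ = (1 / (2 * Real.pi)) * ∫ l : ℝ, ∫ y : ℝ, (Complex.exp (-(Complex.I * l * (x - y : ℝ))) *
          ((r p y : ℂ) * ((q : ℂ) + Ψ l)⁻¹)).re := by
        rw [integral_const_mul, integral_integral_swap hA.re]
    _ = _ := by
        congr 1
        refine integral_congr_ae ?_
        filter_upwards [hA.prod_left_ae] with l hl
        rw [← hR.fourier p hp]
        have e : ∫ y : ℝ, (Complex.exp (-(Complex.I * l * (x - y : ℝ))) *
            ((r p y : ℂ) * ((q : ℂ) + Ψ l)⁻¹)).re = (∫ y : ℝ, Complex.exp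
            (-(Complex.I * l * (x - y : ℝ))) * ((r p y : ℂ) * ((q : ℂ) + Ψ l)⁻¹)).re :=
          integral_re hl
        rw [e, ← integral_mul_const, ← integral_const_mul]
        congr 1
        refine integral_congr_ae (.of_forall fun y => ?_)
        simp only
        rw [show -(Complex.I * l * (x - y : ℝ)) =
          -(Complex.I * l * x) + Complex.I * l * y by push_cast; ring, Complex.exp_add]
        ring

/-- On the Fourier side this is `1/(q+Ψ) - 1/(p+Ψ) = (p-q)/((p+Ψ)(q+Ψ))`. -/
theorem resolvent_eq (hR : IsResolventFamily Ψ r) {p q : ℝ} (hp : 0 < p) (hq : 0 < q)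
    (x y : ℝ) :
    (p - q) * ∫ z, r p (z - x) * r q (y - z) = r q (y - x) - r p (y - x) := by
  have h1 : ∫ z, r p (z - x) * r q (y - z) = ∫ z, r p z * r q (y - x - z) := by
    rw [← integral_sub_right_eq_self (fun z => r p z * r q (y - x - z)) x]
    refine integral_congr_ae (.of_forall fun z => ?_)
    simp only
    congr 2
    ring
  rw [h1, hR.integral_conv hp hq, hR.inversion q hq, hR.inversion p hp, ← mul_sub,
    ← integral_sub (hR.integrable_phase_re hq _) (hR.integrable_phase_re hp _),
    mul_left_comm, ← integral_const_mul]
  congr 1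
  refine integral_congr_ae (.of_forall fun l => ?_)
  simp only
  rw [← Complex.re_ofReal_mul]
  rw [← Complex.sub_re]
  congr 1
  have h2 := hR.add_ne_zero hp l
  have h3 := hR.add_ne_zero hq l
  field_simp
  push_cast
  ring

/-- A form of the maximum principle for the potential of `B • 1_[-ε, ε] - a • δ_y`. -/
theorem maximum_principle (hR : IsResolventFamily Ψ r) {q ε B a y M₀ : ℝ} (hq : 0 < q)
    (hB : 0 ≤ B) (ha : 0 ≤ a) (hM₀ : 0 ≤ M₀)
    (h : ∀ x ∈ Icc (-ε) ε, B * (∫ s in Icc (-ε) ε, r q (s - x)) - a * r q (y - x) ≤ M₀) (x : ℝ) :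
    B * (∫ s in Icc (-ε) ε, r q (s - x)) - a * r q (y - x) ≤ M₀ := by
  set w : ℝ → ℝ := fun x => B * (∫ s in Icc (-ε) ε, r q (s - x)) - a * r q (y - x) with hw
  obtain ⟨C, hC, hrC⟩ := hR.exists_le hq
  have hrn := hR.nonneg q hq
  have hrc := hR.continuous hq
  have hint : ∀ x, ∫ s in Icc (-ε) ε, r q (s - x) ≤ C * volume.real (Icc (-ε) ε) := by
    intro x
    refine (le_abs_self _).trans ?_
    rw [← Real.norm_eq_abs]
    refine norm_setIntegral_le_of_norm_le_const (by simp) fun s _ => ?_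
    rw [Real.norm_eq_abs, abs_of_nonneg (hrn _)]
    exact hrC _
  have hbdd : BddAbove (range w) := by
    refine ⟨B * (C * volume.real (Icc (-ε) ε)), ?_⟩
    rintro _ ⟨x, rfl⟩
    have := mul_nonneg ha (hrn (y - x))
    have := mul_le_mul_of_nonneg_left (hint x) hB
    simp only [hw]
    linarith
  set M := sSup (range w) with hM
  have hwM : ∀ x, w x ≤ M := fun x => le_csSup hbdd ⟨x, rfl⟩
  by_contra! hlt
  have hMM : M₀ < M := hlt.trans_le (hwM x)
  -- Chosen so that `B ≤ (p-q)(M-M₀)`: on the interval, where `w ≤ M₀`, the source `B` then cannot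
  -- lift `(p-q) w + B` above `(p-q) M`. The `1` keeps `p > q` when `B = 0`.
  set p := q + 1 + B / (M - M₀) with hp_def
  have hBM : 0 ≤ B / (M - M₀) := div_nonneg hB (sub_nonneg.2 hMM.le)
  have hp : 0 < p := by linarith
  have hpq : 0 < p - q := by linarith
  have hpB : B ≤ (p - q) * (M - M₀) := by
    have : B / (M - M₀) * (M - M₀) = B := div_mul_cancel₀ _ (sub_pos.2 hMM).ne'
    nlinarith [sub_pos.2 hMM]
  have hrpi := hR.integrable p hp
  have hrpn := hR.nonneg p hp
  have hsh : ∀ x, Integrable fun z => r p (z - x) := fun x => hrpi.comp_sub_right x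
  -- the potential of the interval, integrated against the `p`-resolvent
  have hprod : ∀ x, Integrable (fun z : ℝ × ℝ => r p (z.1 - x) * r q (z.2 - z.1))
      (volume.prod (volume.restrict (Icc (-ε) ε))) := by
    intro x
    have h1 : Integrable (fun z : ℝ × ℝ => r p (z.1 - x) * (1 : ℝ))
        (volume.prod (volume.restrict (Icc (-ε) ε))) :=
      (hsh x).mul_prod (integrable_const (1 : ℝ))
    simp only [mul_one] at h1
    refine h1.mul_bdd (c := C) (by fun_prop) (.of_forall fun z => ?_)
    rw [Real.norm_eq_abs, abs_of_nonneg (hrn _)]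
    exact hrC _
  have hI1 : ∀ x, Integrable fun z => r p (z - x) * ∫ s in Icc (-ε) ε, r q (s - z) := by
    intro x
    refine (hprod x).integral_prod_left.congr (.of_forall fun z => ?_)
    simp only
    rw [integral_const_mul]
  have hI2 : ∀ x, Integrable fun z => r p (z - x) * r q (y - z) := by
    intro x
    refine (hsh x).mul_bdd (c := C) (by fun_prop) (.of_forall fun z => ?_)
    rw [Real.norm_eq_abs, abs_of_nonneg (hrn _)]
    exact hrC _
  have hIw : ∀ x, Integrable fun z => r p (z - x) * w z := by
    intro x
    refine (((hI1 x).const_mul B).sub ((hI2 x).const_mul a)).congr (.of_forall fun z => ?_)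
    simp only [hw, Pi.sub_apply]
    ring
  have hset : ∀ {t : ℝ}, 0 < t → ∀ x, IntegrableOn (fun s => r t (s - x)) (Icc (-ε) ε) := by
    intro t ht x
    exact ((hR.integrable t ht).comp_sub_right x).integrableOn
  -- The resolvent equation for both potentials in `w`: the `q`-potential of a source minus its
  -- `p`-potential is `(p-q)` times the `p`-resolvent of the `q`-potential.
  have key : ∀ x, (p - q) * ∫ z, r p (z - x) * w z =
      w x - (B * (∫ s in Icc (-ε) ε, r p (s - x)) - a * r p (y - x)) := by
    intro x
    have e1 : ∫ z, r p (z - x) * w z = B * (∫ z, r p (z - x) * ∫ s in Icc (-ε) ε, r q (s - z)) -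
        a * ∫ z, r p (z - x) * r q (y - z) := by
      rw [← integral_const_mul, ← integral_const_mul,
        ← integral_sub ((hI1 x).const_mul B) ((hI2 x).const_mul a)]
      refine integral_congr_ae (.of_forall fun z => ?_)
      simp only [hw]
      ring
    have e2 : (p - q) * ∫ z, r p (z - x) * ∫ s in Icc (-ε) ε, r q (s - z) =
        (∫ s in Icc (-ε) ε, r q (s - x)) - ∫ s in Icc (-ε) ε, r p (s - x) := by
      rw [← integral_sub (hset hq x) (hset hp x)]
      have e : ∀ z, r p (z - x) * (∫ s in Icc (-ε) ε, r q (s - z)) =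
          ∫ s in Icc (-ε) ε, r p (z - x) * r q (s - z) := fun z => (integral_const_mul _ _).symm
      simp_rw [e]
      rw [integral_integral_swap (hprod x), ← integral_const_mul]
      exact integral_congr_ae (.of_forall fun s => hR.resolvent_eq hp hq x s)
    have e3 := hR.resolvent_eq hp hq x y
    rw [e1, mul_sub, mul_left_comm, e2, mul_left_comm, e3]
    simp only [hw]
    ring
  have hind : ∀ x, Integrable fun z => r p (z - x) * (Icc (-ε) ε).indicator (fun _ => B) z := by
    intro x
    refine (hsh x).mul_bdd (c := B) ?_ (.of_forall fun z => ?_)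
    · exact (measurable_const.indicator measurableSet_Icc).aestronglyMeasurable
    · by_cases hz : z ∈ Icc (-ε) ε
      · simp [indicator_of_mem hz, abs_of_nonneg hB]
      · simp [indicator_of_notMem hz, hB]
  have hind_eq : ∀ x, ∫ z, r p (z - x) * (Icc (-ε) ε).indicator (fun _ => B) z =
      B * ∫ s in Icc (-ε) ε, r p (s - x) := by
    intro x
    rw [← integral_const_mul, ← integral_indicator measurableSet_Icc]
    refine integral_congr_ae (.of_forall fun z => ?_)
    by_cases hz : z ∈ Icc (-ε) ε
    · simp [indicator_of_mem hz, mul_comm]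
    · simp [indicator_of_notMem hz]
  -- Dropping the term in `a` bounds `w` by the `p`-resolvent of `(p-q) w + B 1_[-ε,ε] ≤ (p-q) M`,
  -- and `r p` has mass `1/p`. As `(p-q)/p < 1` and `M > 0`, this is impossible for the supremum.
  have hup : ∀ x, w x ≤ (p - q) / p * M := by
    intro x
    have h1 : w x ≤ (p - q) * (∫ z, r p (z - x) * w z) +
        ∫ z, r p (z - x) * (Icc (-ε) ε).indicator (fun _ => B) z := by
      rw [key, hind_eq]
      have := mul_nonneg ha (hrpn (y - x))
      linarith
    have h2 : (p - q) * (∫ z, r p (z - x) * w z) +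
        ∫ z, r p (z - x) * (Icc (-ε) ε).indicator (fun _ => B) z ≤
        ∫ z, r p (z - x) * ((p - q) * M) := by
      rw [← integral_const_mul, ← integral_add ((hIw x).const_mul _) (hind x)]
      refine integral_mono (((hIw x).const_mul _).add (hind x)) ((hsh x).mul_const _) fun z => ?_
      simp only
      rw [mul_left_comm, ← mul_add]
      refine mul_le_mul_of_nonneg_left ?_ (hrpn _)
      by_cases hz : z ∈ Icc (-ε) ε
      · rw [indicator_of_mem hz]
        have := mul_le_mul_of_nonneg_left (h z hz) hpq.le
        simp only [hw] at this ⊢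
        linarith
      · rw [indicator_of_notMem hz, add_zero]
        exact mul_le_mul_of_nonneg_left (hwM z) hpq.le
    have h3 : ∫ z, r p (z - x) * ((p - q) * M) = (p - q) / p * M := by
      rw [integral_mul_const, integral_sub_right_eq_self (r p), hR.integral_eq hp]
      field_simp
    linarith
  have hMle : M ≤ (p - q) / p * M := csSup_le (range_nonempty w) (by rintro _ ⟨x, rfl⟩; exact hup x)
  have hlt1 : (p - q) / p < 1 := by rw [div_lt_one hp]; linarith
  have hMpos : 0 < M := hM₀.trans_lt hMM
  nlinarith

end IsResolventFamily

/-- `h_q(x) = r_q(0) - r_q(-x)` for a family of functions `r_q`. -/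
def resolventDiff (r : ℝ → ℝ → ℝ) (q x : ℝ) : ℝ := r q 0 - r q (-x)

/-- A majorant of the symmetrized `resolventDiff`, uniform in `q`. -/
noncomputable def symmMajorant (Ψ : ℝ → ℂ) (x : ℝ) : ℝ :=
  (1 / Real.pi) * ∫ l : ℝ, (1 - Real.cos (l * x)) / ‖Ψ l‖

theorem one_sub_cos_nonneg (x : ℝ) : 0 ≤ 1 - Real.cos x := sub_nonneg.2 (Real.cos_le_one x)

theorem one_sub_cos_le_sq (x : ℝ) : 1 - Real.cos x ≤ x ^ 2 / 2 := by
  have := Real.one_sub_sq_div_two_le_cos (x := x)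
  linarith

theorem one_sub_cos_mul_le (l x : ℝ) :
    1 - Real.cos (l * x) ≤ 2 * max 1 (x ^ 2) * min 1 (l ^ 2) := by
  have h1 : 1 - Real.cos (l * x) ≤ 2 := by linarith [Real.neg_one_le_cos (l * x)]
  have h2 := one_sub_cos_le_sq (l * x)
  have h3 : (1 : ℝ) ≤ max 1 (x ^ 2) := le_max_left _ _
  have h4 : x ^ 2 ≤ max 1 (x ^ 2) := le_max_right _ _
  rcases min_cases (1 : ℝ) (l ^ 2) with ⟨h, _⟩ | ⟨h, _⟩
  · rw [h]
    linarith
  · rw [h]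
    have h5 := mul_le_mul_of_nonneg_left h4 (sq_nonneg l)
    have h6 : 0 ≤ max 1 (x ^ 2) * l ^ 2 := by positivity
    nlinarith

/-! ### Domination principle and subadditivity of `h_q`. -/

namespace IsResolventFamily

variable {Ψ : ℝ → ℂ} {r : ℝ → ℝ → ℝ}

/-- The domination principle for the potentials of `c • δ_0` and `a • δ_y`. -/
theorem domination_principle (hR : IsResolventFamily Ψ r) {q c a y M₀ : ℝ} (hq : 0 < q)
    (hc : 0 ≤ c) (ha : 0 ≤ a) (hM₀ : 0 ≤ M₀) (h : c * r q 0 - a * r q y ≤ M₀) (x : ℝ) :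
    c * r q (-x) - a * r q (y - x) ≤ M₀ := by
  have hrc := hR.continuous hq
  refine le_of_forall_pos_le_add fun δ hδ => ?_
  -- The point mass `c` at `0` is replaced by density `c/(2ε)` on `[-ε, ε]`. Continuity errors cost
  -- `(c+a)δ'` in the hypothesis and `cδ'` in the conclusion, hence `2c + a`; the `1` avoids
  -- division by zero.
  set δ' := δ / (2 * c + a + 1) with hδ'
  have hden : 0 < 2 * c + a + 1 := by positivity
  have hδ'0 : 0 < δ' := by positivity
  obtain ⟨η₁, hη₁, H₁⟩ := Metric.continuousAt_iff.1 (hrc.continuousAt (x := 0)) δ' hδ'0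
  obtain ⟨η₂, hη₂, H₂⟩ := Metric.continuousAt_iff.1 (hrc.continuousAt (x := y)) δ' hδ'0
  obtain ⟨η₃, hη₃, H₃⟩ := Metric.continuousAt_iff.1 (hrc.continuousAt (x := -x)) δ' hδ'0
  set ε := min η₁ (min η₂ η₃) / 4 with hε
  have hmin : 0 < min η₁ (min η₂ η₃) := lt_min hη₁ (lt_min hη₂ hη₃)
  have hε0 : 0 < ε := by positivity
  have hε1 : 4 * ε ≤ η₁ := by rw [hε]; linarith [min_le_left η₁ (min η₂ η₃)]
  have hε2 : 4 * ε ≤ η₂ := by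
    rw [hε]; linarith [(min_le_right η₁ (min η₂ η₃)).trans (min_le_left η₂ η₃)]
  have hε3 : 4 * ε ≤ η₃ := by
    rw [hε]; linarith [(min_le_right η₁ (min η₂ η₃)).trans (min_le_right η₂ η₃)]
  have hvol : volume.real (Icc (-ε) ε) = 2 * ε := by
    rw [Real.volume_real_Icc_of_le (by linarith)]; ring
  have hset : ∀ x, IntegrableOn (fun s => r q (s - x)) (Icc (-ε) ε) := fun x =>
    ((hR.integrable q hq).comp_sub_right x).integrableOn
  have hBε : c / (2 * ε) * (2 * ε) = c := div_mul_cancel₀ _ (by positivity)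
  have hw : ∀ x ∈ Icc (-ε) ε, c / (2 * ε) * (∫ s in Icc (-ε) ε, r q (s - x)) - a * r q (y - x)
      ≤ M₀ + (c + a) * δ' := by
    intro x hx
    have h1 : ∫ s in Icc (-ε) ε, r q (s - x) ≤ 2 * ε * (r q 0 + δ') := by
      calc _ ≤ ∫ s in Icc (-ε) ε, (r q 0 + δ') := by
            refine setIntegral_mono_on (hset x) (integrableOn_const (by simp)) measurableSet_Icc
              fun s hs => ?_
            have := H₁ (x := s - x) (by
              rw [Real.dist_eq, sub_zero, abs_lt]
              constructor <;> linarith [hs.1, hs.2, hx.1, hx.2])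
            rw [Real.dist_eq, abs_lt] at this
            linarith [this.2]
        _ = _ := by rw [setIntegral_const, hvol, smul_eq_mul]
    have h2 := H₂ (x := y - x) (by
      rw [Real.dist_eq, abs_lt]; constructor <;> linarith [hx.1, hx.2])
    rw [Real.dist_eq, abs_lt] at h2
    have h3 := mul_le_mul_of_nonneg_left h1 (a := c / (2 * ε)) (by positivity)
    rw [← mul_assoc, hBε] at h3
    have h4 := mul_le_mul_of_nonneg_left h2.1.le ha
    nlinarith
  have h1 := hR.maximum_principle hq (a := a) (B := c / (2 * ε)) (by positivity) ha
    (by positivity) hw x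
  have h2 : 2 * ε * (r q (-x) - δ') ≤ ∫ s in Icc (-ε) ε, r q (s - x) := by
    calc _ = ∫ s in Icc (-ε) ε, (r q (-x) - δ') := by rw [setIntegral_const, hvol, smul_eq_mul]
      _ ≤ _ := by
        refine setIntegral_mono_on (integrableOn_const (by simp)) (hset x) measurableSet_Icc
          fun s hs => ?_
        have := H₃ (x := s - x) (by
          rw [Real.dist_eq, abs_lt]; constructor <;> linarith [hs.1, hs.2])
        rw [Real.dist_eq, abs_lt] at this
        linarith [this.1]
  have h3 := mul_le_mul_of_nonneg_left h2 (a := c / (2 * ε)) (by positivity)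
  rw [← mul_assoc, hBε] at h3
  have h4 : (2 * c + a) * δ' ≤ δ := by
    have : δ = (2 * c + a + 1) * δ' := by rw [hδ']; field_simp
    nlinarith
  nlinarith

theorem le_zero (hR : IsResolventFamily Ψ r) {q : ℝ} (hq : 0 < q) (x : ℝ) : r q x ≤ r q 0 := by
  have := hR.domination_principle hq (c := 1) (a := 0) (y := 0) zero_le_one le_rfl
    (hR.nonneg q hq 0) (by simp) (-x)
  simpa using this

theorem zero_pos (hR : IsResolventFamily Ψ r) {q : ℝ} (hq : 0 < q) : 0 < r q 0 := by
  refine lt_of_le_of_ne (hR.nonneg q hq 0) fun h => ?_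
  have h1 : r q = fun _ => 0 := by
    ext x
    exact le_antisymm ((hR.le_zero hq x).trans h.symm.le) (hR.nonneg q hq x)
  have h2 := hR.integral_eq hq
  rw [h1] at h2
  simp at h2
  exact hq.ne h2

/-- The weights `c = r_q(y)` and `a = r_q(0)` make the difference of potentials vanish at `0`, so it
is nonpositive everywhere. -/
theorem mul_le (hR : IsResolventFamily Ψ r) {q : ℝ} (hq : 0 < q) (x y : ℝ) :
    r q x * r q y ≤ r q 0 * r q (x + y) := by
  have := hR.domination_principle hq (c := r q y) (a := r q 0) (y := y) (hR.nonneg q hq y)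
    (hR.nonneg q hq 0) le_rfl (by linarith) (-x)
  rw [neg_neg, sub_neg_eq_add, add_comm y x] at this
  linarith

theorem diff_nonneg (hR : IsResolventFamily Ψ r) {q : ℝ} (hq : 0 < q) (x : ℝ) :
    0 ≤ resolventDiff r q x := sub_nonneg.2 (hR.le_zero hq _)

/-- By `mul_le`, `r_q(0) (h_q(x) + h_q(y) - h_q(x+y)) ≥ h_q(x) h_q(y) ≥ 0`. -/
theorem diff_add_le (hR : IsResolventFamily Ψ r) {q : ℝ} (hq : 0 < q) (x y : ℝ) :
    resolventDiff r q (x + y) ≤ resolventDiff r q x + resolventDiff r q y := by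
  have h1 := hR.mul_le hq (-x) (-y)
  have h2 := hR.zero_pos hq
  have h3 := mul_nonneg (hR.diff_nonneg hq x) (hR.diff_nonneg hq y)
  unfold resolventDiff at h3 ⊢
  rw [← neg_add] at h1
  refine le_of_mul_le_mul_left ?_ h2
  nlinarith

theorem diff_eq (hR : IsResolventFamily Ψ r) {q : ℝ} (hq : 0 < q) (x : ℝ) :
    resolventDiff r q x = (1 / (2 * Real.pi)) *
      ∫ l : ℝ, ((1 - Complex.exp (Complex.I * l * x)) / ((q : ℂ) + Ψ l)).re := by
  rw [resolventDiff, hR.inversion q hq 0, hR.inversion q hq (-x), ← mul_sub,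
    ← integral_sub (hR.integrable_phase_re hq _) (hR.integrable_phase_re hq _)]
  congr 1
  refine integral_congr_ae (.of_forall fun l => ?_)
  simp only
  rw [← Complex.sub_re, ← sub_mul, div_eq_mul_inv]
  simp

theorem integrable_diff (hR : IsResolventFamily Ψ r) {q : ℝ} (hq : 0 < q) (x : ℝ) :
    Integrable fun l : ℝ => ((1 - Complex.exp (Complex.I * l * x)) / ((q : ℂ) + Ψ l)).re := by
  refine ((hR.integrable_phase_re hq 0).sub (hR.integrable_phase_re hq (-x))).congr
    (.of_forall fun l => ?_)
  simp only [Pi.sub_apply]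
  rw [← Complex.sub_re, ← sub_mul, div_eq_mul_inv]
  simp

/-! ### Lower bounds for `|Ψ|`. -/

theorem norm_le_norm_add (hR : IsResolventFamily Ψ r) {q : ℝ} (hq : 0 ≤ q) (l : ℝ) :
    ‖Ψ l‖ ≤ ‖(q : ℂ) + Ψ l‖ := by
  have h := hR.re_nonneg l
  rw [Complex.norm_def, Complex.norm_def]
  refine Real.sqrt_le_sqrt ?_
  rw [Complex.normSq_apply, Complex.normSq_apply]
  simp
  nlinarith

/-- `∫ (1 - cos (l x)) r_1(x) dx`. -/
theorem integral_one_sub_cos (hR : IsResolventFamily Ψ r) (l : ℝ) :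
    ∫ x, (1 - Real.cos (l * x)) * r 1 x = 1 - ((1 + Ψ l)⁻¹).re := by
  have h1 := hR.fourier 1 one_pos l
  have hi := hR.integrable 1 one_pos
  have hi2 : Integrable fun x : ℝ => Complex.exp (Complex.I * l * x) * (r 1 x : ℂ) := by
    refine (hi.ofReal (𝕜 := ℂ)).bdd_mul (c := 1) (by fun_prop) (.of_forall fun x => ?_)
    rw [Complex.norm_exp]
    simp
  have h2 : ∫ x : ℝ, Real.cos (l * x) * r 1 x = ((1 + Ψ l)⁻¹).re := by
    rw [← Complex.ofReal_one, ← h1]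
    refine Eq.trans ?_ (integral_re hi2)
    refine integral_congr_ae (.of_forall fun x => ?_)
    change _ = Complex.re _
    rw [Complex.re_mul_ofReal, Complex.exp_re]
    simp
  have hi3 : Integrable fun x : ℝ => Real.cos (l * x) * r 1 x :=
    hi.bdd_mul (c := 1) (by fun_prop) (.of_forall fun x => Real.abs_cos_le_one _)
  simp_rw [sub_mul, one_mul]
  rw [integral_sub hi hi3, h2, hR.integral_eq one_pos, inv_one]

theorem integrable_one_sub_cos (hR : IsResolventFamily Ψ r) (l : ℝ) :
    Integrable fun x => (1 - Real.cos (l * x)) * r 1 x :=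
  (hR.integrable 1 one_pos).bdd_mul (c := 2) (by fun_prop) (.of_forall fun x => by
    rw [Real.norm_eq_abs, abs_of_nonneg (one_sub_cos_nonneg _)]
    linarith [Real.neg_one_le_cos (l * x)])

theorem one_le_norm_add (hR : IsResolventFamily Ψ r) (l : ℝ) : 1 ≤ ‖1 + Ψ l‖ := by
  have h1 := Complex.abs_re_le_norm (1 + Ψ l)
  have h2 := le_abs_self (1 + Ψ l).re
  have h3 := hR.re_nonneg l
  simp at h1 h2
  linarith

theorem integral_one_sub_cos_le (hR : IsResolventFamily Ψ r) (l : ℝ) :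
    ∫ x, (1 - Real.cos (l * x)) * r 1 x ≤ ‖Ψ l‖ := by
  have h0 : 1 + Ψ l ≠ 0 := by simpa using hR.add_ne_zero one_pos l
  rw [hR.integral_one_sub_cos]
  have h1 : 1 - ((1 + Ψ l)⁻¹).re = (Ψ l * (1 + Ψ l)⁻¹).re := by
    rw [← Complex.one_re, ← Complex.sub_re]
    congr 1
    field_simp
    ring
  rw [h1]
  refine (Complex.re_le_norm _).trans ?_
  rw [norm_mul, norm_inv]
  exact mul_le_of_le_one_right (norm_nonneg _) (inv_le_one_of_one_le₀ (hR.one_le_norm_add l))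

/-- Uses `1 - cos θ ≥ 2θ²/π²` for `|θ| ≤ π`. The truncated second moment of `r_1` thus controls
`|Ψ|` from below near `0`. -/
theorem sq_mul_setIntegral_le (hR : IsResolventFamily Ψ r) {N l : ℝ} (hl : |l| * N ≤ 1) :
    2 / Real.pi ^ 2 * l ^ 2 * ∫ x in Icc (-N) N, x ^ 2 * r 1 x ≤
      ∫ x, (1 - Real.cos (l * x)) * r 1 x := by
  have hc := hR.continuous one_pos
  rw [← integral_const_mul]
  refine le_trans ?_ (setIntegral_le_integral (s := Icc (-N) N) (hR.integrable_one_sub_cos l)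
    (.of_forall fun x => mul_nonneg (one_sub_cos_nonneg _) (hR.nonneg 1 one_pos x)))
  refine setIntegral_mono_on ?_ (hR.integrable_one_sub_cos l).integrableOn measurableSet_Icc
    fun x hx => ?_
  · exact (Continuous.continuousOn (by fun_prop)).integrableOn_compact isCompact_Icc
  · rw [← mul_assoc]
    refine mul_le_mul_of_nonneg_right ?_ (hR.nonneg 1 one_pos x)
    have h1 : |l * x| ≤ Real.pi := by
      rw [abs_mul]
      have h2 : |x| ≤ N := abs_le.2 hx
      have := mul_le_mul_of_nonneg_left h2 (abs_nonneg l)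
      linarith [Real.pi_gt_three]
    have := Real.cos_le_one_sub_mul_cos_sq h1
    nlinarith

theorem integral_one_sub_cos_pos (hR : IsResolventFamily Ψ r) {l : ℝ} (hl : l ≠ 0) :
    0 < ∫ x, (1 - Real.cos (l * x)) * r 1 x := by
  have hc := hR.continuous one_pos
  have hcont : Continuous fun x => (1 - Real.cos (l * x)) * r 1 x := by fun_prop
  rw [integral_pos_iff_support_of_nonneg (fun x => mul_nonneg (one_sub_cos_nonneg _)
    (hR.nonneg 1 one_pos x)) (hR.integrable_one_sub_cos l)]
  refine hcont.isOpen_support.measure_pos _ ?_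
  obtain ⟨ε, hε, H⟩ := Metric.eventually_nhds_iff.1
    (hc.continuousAt.eventually (lt_mem_nhds (hR.zero_pos one_pos)))
  have hl' : 0 < |l| := abs_pos.2 hl
  set x := min (ε / 2) (1 / |l|) with hx
  have hx0 : 0 < x := by positivity
  refine ⟨x, mul_ne_zero ?_ (H ?_).ne'⟩
  · have h1 : |l * x| ≤ 1 := by
      rw [abs_mul, abs_of_pos hx0]
      calc |l| * x ≤ |l| * (1 / |l|) := by gcongr; exact min_le_right _ _
        _ = 1 := by field_simp
    have h2 := Real.cos_le_one_sub_mul_cos_sq (h1.trans (by linarith [Real.pi_gt_three]))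
    have h3 : 0 < 2 / Real.pi ^ 2 * (l * x) ^ 2 := by
      have : l * x ≠ 0 := mul_ne_zero hl hx0.ne'
      have := Real.pi_pos
      positivity
    linarith
  · rw [Real.dist_eq, sub_zero, abs_of_pos hx0]
    linarith [min_le_left (ε / 2) (1 / |l|)]

/-- The Riemann–Lebesgue lemma for `r_1`, rescaled to the frequency convention of `Ψ`. -/
theorem tendsto_inv_cocompact (hR : IsResolventFamily Ψ r) :
    Tendsto (fun l => (1 + Ψ l)⁻¹) (cocompact ℝ) (𝓝 0) := by
  have h1 := Real.tendsto_integral_exp_smul_cocompact (fun x => (r 1 x : ℂ))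
  have h2 : Tendsto (fun l : ℝ => -(2 * Real.pi)⁻¹ * l) (cocompact ℝ) (cocompact ℝ) :=
    tendsto_cocompact_mul_left₀ (neg_ne_zero.2 (by positivity))
  refine (h1.comp h2).congr fun l => ?_
  have h3 := hR.fourier 1 one_pos l
  rw [Complex.ofReal_one] at h3
  rw [← h3, Function.comp_apply]
  refine integral_congr_ae (.of_forall fun x => ?_)
  simp only
  rw [Circle.smul_def, Real.fourierChar_apply, smul_eq_mul]
  congr 2
  have : (Real.pi : ℂ) ≠ 0 := by exact_mod_cast Real.pi_ne_zero
  push_cast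
  field_simp

/-- Three ranges of `l`: for `|l| ≤ 1` the second moment over `[-1, 1]` gives a quadratic bound;
near infinity the integral tends to `1`; on the compact range between them it is continuous and
positive. With `integral_one_sub_cos_le` this bounds `|Ψ|` below. -/
theorem exists_mul_min_le (hR : IsResolventFamily Ψ r) :
    ∃ c, 0 < c ∧ ∀ l, c * min 1 (l ^ 2) ≤ ∫ x, (1 - Real.cos (l * x)) * r 1 x := by
  have hc := hR.continuous one_pos
  have hκc : Continuous fun l => ∫ x, (1 - Real.cos (l * x)) * r 1 x := by
    simp_rw [hR.integral_one_sub_cos]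
    have := hR.continuous_exponent
    refine continuous_const.sub (Complex.continuous_re.comp ((by fun_prop : Continuous fun l =>
      1 + Ψ l).inv₀ fun l => ?_))
    simpa using hR.add_ne_zero one_pos l
  have hinf : Tendsto (fun l => ∫ x, (1 - Real.cos (l * x)) * r 1 x) (cocompact ℝ) (𝓝 1) := by
    simp_rw [hR.integral_one_sub_cos]
    have := (Complex.continuous_re.tendsto 0).comp hR.tendsto_inv_cocompact
    simpa using! this.const_sub 1
  have h1 := hinf.eventually (lt_mem_nhds (show (1 / 2 : ℝ) < 1 by norm_num))
  obtain ⟨K, hK, hK'⟩ := mem_cocompact.1 h1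
  have hS : IsClosed {l : ℝ | 1 ≤ |l|} := isClosed_le continuous_const continuous_abs
  obtain ⟨c₂, hc₂, H₂⟩ := (hK.inter_right hS).exists_forall_le' (a := 0) hκc.continuousOn
    (fun l hl => hR.integral_one_sub_cos_pos (fun h => by
      have := hl.2
      simp [h] at this
      linarith))
  have hpos : 0 < ∫ x in Icc (-1 : ℝ) 1, x ^ 2 * r 1 x := by
    have hcont : Continuous fun x => x ^ 2 * r 1 x := by fun_prop
    rw [setIntegral_pos_iff_support_of_nonneg_ae
      (.of_forall fun x => mul_nonneg (sq_nonneg x) (hR.nonneg 1 one_pos x))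
      (hcont.continuousOn.integrableOn_compact isCompact_Icc)]
    refine ((hcont.isOpen_support.inter isOpen_Ioo).measure_pos volume ?_).trans_le
      (measure_mono (inter_subset_inter_right _ Ioo_subset_Icc_self))
    obtain ⟨ε, hε, H⟩ := Metric.eventually_nhds_iff.1
      (hc.continuousAt.eventually (lt_mem_nhds (hR.zero_pos one_pos)))
    have hx0 : 0 < min (ε / 2) (1 / 2) := by positivity
    refine ⟨min (ε / 2) (1 / 2), mul_ne_zero (pow_ne_zero _ hx0.ne') (H ?_).ne',
      by linarith, by linarith [min_le_right (ε / 2) (1 / 2 : ℝ)]⟩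
    rw [Real.dist_eq, sub_zero, abs_of_pos hx0]
    linarith [min_le_left (ε / 2) (1 / 2 : ℝ)]
  set c₁ := 2 / Real.pi ^ 2 * ∫ x in Icc (-1 : ℝ) 1, x ^ 2 * r 1 x with hc₁
  have hc₁0 : 0 < c₁ := by
    have := Real.pi_pos
    positivity
  refine ⟨min c₁ (min c₂ (1 / 2)), by positivity, fun l => ?_⟩
  rcases le_or_gt |l| 1 with hl | hl
  · have h2 := hR.sq_mul_setIntegral_le (N := 1) (l := l) (by simpa using hl)
    have h3 : min c₁ (min c₂ (1 / 2)) * min 1 (l ^ 2) ≤ c₁ * l ^ 2 := by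
      gcongr
      · exact min_le_left _ _
      · exact min_le_right _ _
    calc _ ≤ _ := h3
      _ = _ := by rw [hc₁]; ring
      _ ≤ _ := h2
  · have h4 : min c₁ (min c₂ (1 / 2)) * min 1 (l ^ 2) ≤ min c₂ (1 / 2) :=
      (mul_le_of_le_one_right (by positivity) (min_le_left _ _)).trans (min_le_right _ _)
    by_cases hlK : l ∈ K
    · exact h4.trans ((min_le_left _ _).trans (H₂ l ⟨hlK, hl.le⟩))
    · exact h4.trans ((min_le_right _ _).trans (hK' hlK).le)

end IsResolventFamily

/-! ### The majorant `ω`: equicontinuity of `h_q` and growth at infinity. -/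

theorem one_sub_cos_le_div (θ : ℝ) : 1 - Real.cos θ ≤ 4 * θ ^ 2 * (1 + θ ^ 2)⁻¹ := by
  have h1 : 1 - Real.cos θ ≤ 2 := by linarith [Real.neg_one_le_cos θ]
  have h2 := one_sub_cos_le_sq θ
  rw [← div_eq_mul_inv, le_div_iff₀ (by positivity)]
  rcases le_or_gt (θ ^ 2) 4 with h | h
  · nlinarith [sq_nonneg θ]
  · nlinarith [sq_nonneg θ]

namespace IsResolventFamily

variable {Ψ : ℝ → ℂ} {r : ℝ → ℝ → ℝ}

theorem norm_exponent_pos (hR : IsResolventFamily Ψ r) {l : ℝ} (hl : l ≠ 0) : 0 < ‖Ψ l‖ :=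
  (hR.integral_one_sub_cos_pos hl).trans_le (hR.integral_one_sub_cos_le l)

/-- Comparison with `1/|1+Ψ|`, integrable by (A): `|1+Ψ| ≤ 1 + |Ψ|`, and `min(1, l²) ≤ |Ψ|/c`
absorbs the `1`. -/
theorem integrable_min_div (hR : IsResolventFamily Ψ r) :
    Integrable fun l => min 1 (l ^ 2) / ‖Ψ l‖ := by
  obtain ⟨c, hc, H⟩ := hR.exists_mul_min_le
  have hm := hR.continuous_exponent.measurable
  refine Integrable.mono' (((hR.integrable_inv 1 one_pos).norm).const_mul (1 + c⁻¹))
    (Measurable.aestronglyMeasurable (by fun_prop)) (.of_forall fun l => ?_)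
  rw [Real.norm_eq_abs, abs_of_nonneg (by positivity), norm_inv, Complex.ofReal_one]
  rcases eq_or_ne l 0 with rfl | hl
  · simp
    positivity
  have h0 := hR.norm_exponent_pos hl
  have h1 : 0 < ‖1 + Ψ l‖ := one_pos.trans_le (hR.one_le_norm_add l)
  rw [← div_eq_mul_inv, div_le_div_iff₀ h0 h1]
  have h2 : ‖1 + Ψ l‖ ≤ 1 + ‖Ψ l‖ := (norm_add_le _ _).trans (by simp)
  have h3 : min 1 (l ^ 2) ≤ c⁻¹ * ‖Ψ l‖ := by
    rw [← div_eq_inv_mul, le_div_iff₀ hc, mul_comm]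
    exact (H l).trans (hR.integral_one_sub_cos_le l)
  have h4 : (0 : ℝ) ≤ min 1 (l ^ 2) := by positivity
  calc min 1 (l ^ 2) * ‖1 + Ψ l‖ ≤ min 1 (l ^ 2) * (1 + ‖Ψ l‖) := by gcongr
    _ ≤ c⁻¹ * ‖Ψ l‖ + 1 * ‖Ψ l‖ := by
        rw [mul_add, mul_one]
        gcongr
        exact min_le_left _ _
    _ = _ := by ring

theorem integrable_one_sub_cos_div (hR : IsResolventFamily Ψ r) (x : ℝ) :
    Integrable fun l => (1 - Real.cos (l * x)) / ‖Ψ l‖ := by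
  have hm := hR.continuous_exponent.measurable
  refine Integrable.mono' (hR.integrable_min_div.const_mul (2 * max 1 (x ^ 2)))
    (Measurable.aestronglyMeasurable (by fun_prop)) (.of_forall fun l => ?_)
  rw [Real.norm_eq_abs, abs_of_nonneg (div_nonneg (one_sub_cos_nonneg _) (norm_nonneg _)),
    ← mul_div_assoc]
  gcongr
  exact one_sub_cos_mul_le l x

theorem tendsto_symmMajorant (hR : IsResolventFamily Ψ r) :
    Tendsto (symmMajorant Ψ) (𝓝 0) (𝓝 0) := by
  have hm := hR.continuous_exponent.measurable
  have h : Tendsto (fun x => ∫ l : ℝ, (1 - Real.cos (l * x)) / ‖Ψ l‖) (𝓝 0)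
      (𝓝 (∫ l : ℝ, (0 : ℝ))) := by
    refine tendsto_integral_filter_of_dominated_convergence
      (fun l => 2 * (min 1 (l ^ 2) / ‖Ψ l‖))
      (.of_forall fun x => Measurable.aestronglyMeasurable (by fun_prop)) ?_
      (hR.integrable_min_div.const_mul 2) (.of_forall fun l => ?_)
    · filter_upwards [Metric.ball_mem_nhds (0 : ℝ) one_pos] with x hx
      refine .of_forall fun l => ?_
      rw [Real.norm_eq_abs, abs_of_nonneg (div_nonneg (one_sub_cos_nonneg _) (norm_nonneg _)),
        ← mul_div_assoc]
      gcongr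
      have h1 := one_sub_cos_mul_le l x
      rw [Metric.mem_ball, Real.dist_eq, sub_zero] at hx
      have : x ^ 2 ≤ 1 := by rw [sq_le_one_iff_abs_le_one]; exact hx.le
      rwa [max_eq_left this, mul_one] at h1
    · have : Continuous fun x => (1 - Real.cos (l * x)) / ‖Ψ l‖ := by fun_prop
      simpa using this.tendsto 0
  have h2 := h.const_mul (1 / Real.pi)
  rw [integral_zero, mul_zero] at h2
  exact h2

/-- Symmetrizing cancels the sine part, leaving `(1 - cos) Re 1/(q+Ψ)`, and `|q+Ψ| ≥ |Ψ|` because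
`Re Ψ ≥ 0`. -/
theorem diff_add_diff_neg_le (hR : IsResolventFamily Ψ r) {q : ℝ} (hq : 0 < q) (x : ℝ) :
    resolventDiff r q x + resolventDiff r q (-x) ≤ symmMajorant Ψ x := by
  rw [hR.diff_eq hq, hR.diff_eq hq, ← mul_add,
    ← integral_add (hR.integrable_diff hq _) (hR.integrable_diff hq _), symmMajorant,
    show (1 : ℝ) / (2 * Real.pi) = 1 / Real.pi * 2⁻¹ by field_simp, mul_assoc,
    ← integral_const_mul 2⁻¹]
  refine mul_le_mul_of_nonneg_left ?_ (by positivity)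
  refine integral_mono (((hR.integrable_diff hq x).add (hR.integrable_diff hq (-x))).const_mul _)
    (hR.integrable_one_sub_cos_div x) fun l => ?_
  simp only
  have e : (2⁻¹ : ℝ) * (((1 - Complex.exp (Complex.I * l * x)) / ((q : ℂ) + Ψ l)).re +
      ((1 - Complex.exp (Complex.I * l * (-x : ℝ))) / ((q : ℂ) + Ψ l)).re) =
      (1 - Real.cos (l * x)) * (((q : ℂ) + Ψ l)⁻¹).re := by
    rw [← Complex.re_ofReal_mul, ← Complex.add_re, ← Complex.re_ofReal_mul]
    congr 1
    push_cast
    rw [Complex.cos, show Complex.I * l * x = l * x * Complex.I by ring,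
      show Complex.I * l * -x = -(l * x) * Complex.I by ring]
    ring
  rw [e, div_eq_mul_inv]
  rcases eq_or_ne l 0 with rfl | hl
  · simp
  refine mul_le_mul_of_nonneg_left ?_ (one_sub_cos_nonneg _)
  refine (Complex.re_le_norm _).trans ?_
  rw [norm_inv]
  exact inv_anti₀ (hR.norm_exponent_pos hl) (hR.norm_le_norm_add hq.le l)

theorem diff_le (hR : IsResolventFamily Ψ r) {q : ℝ} (hq : 0 < q) (x : ℝ) :
    resolventDiff r q x ≤ symmMajorant Ψ x := by
  linarith [hR.diff_add_diff_neg_le hq x, hR.diff_nonneg hq (-x)]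

/-- Subadditivity bounds the difference by `h_q(x-y)` on one side and by `h_q(y-x)` on the other;
both are at most `ω(x-y)`. -/
theorem abs_diff_sub_le (hR : IsResolventFamily Ψ r) {q : ℝ} (hq : 0 < q) (x y : ℝ) :
    |resolventDiff r q x - resolventDiff r q y| ≤ symmMajorant Ψ (x - y) := by
  have h1 := hR.diff_add_diff_neg_le hq (x - y)
  have h2 := hR.diff_nonneg hq (x - y)
  have h3 := hR.diff_nonneg hq (-(x - y))
  have h4 := hR.diff_add_le hq (x - y) y
  have h5 := hR.diff_add_le hq (-(x - y)) x
  rw [sub_add_cancel] at h4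
  rw [show -(x - y) + x = y by ring] at h5
  rw [abs_le]
  constructor <;> linarith

theorem exists_lt_setIntegral (hR : IsResolventFamily Ψ r)
    (hinf : ¬ Integrable fun x => x ^ 2 * r 1 x) (Λ : ℝ) :
    ∃ N : ℝ, 0 < N ∧ Λ < ∫ x in Icc (-N) N, x ^ 2 * r 1 x := by
  have hc := hR.continuous one_pos
  by_contra! hcon
  refine hinf ?_
  have hcov : AECover volume atTop fun n : ℕ => Icc (-((n : ℝ) + 1)) ((n : ℝ) + 1) :=
    aecover_Icc (tendsto_neg_atTop_atBot.comp
      (tendsto_atTop_add_const_right _ _ tendsto_natCast_atTop_atTop))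
      (tendsto_atTop_add_const_right _ _ tendsto_natCast_atTop_atTop)
  refine hcov.integrable_of_integral_bounded_of_nonneg_ae Λ (fun n => ?_)
    (.of_forall fun x => mul_nonneg (sq_nonneg x) (hR.nonneg 1 one_pos x))
    (.of_forall fun n => hcon _ (by positivity))
  exact (Continuous.continuousOn (by fun_prop)).integrableOn_compact isCompact_Icc

/-- An infinite second moment gives `|Ψ(l)| ≥ (4/η) l²` near `0`. There the integrand is at most `η
x²/(1+(xl)²)`, whose integral is `πη|x|`; the remaining frequencies contribute a constant. -/
theorem exists_symmMajorant_le (hR : IsResolventFamily Ψ r)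
    (hinf : ¬ Integrable fun x => x ^ 2 * r 1 x) {η : ℝ} (hη : 0 < η) :
    ∃ A, ∀ x, symmMajorant Ψ x ≤ η * |x| + A := by
  obtain ⟨N, hN, hΛ⟩ := hR.exists_lt_setIntegral hinf (Real.pi ^ 2 / 2 * (4 / η))
  set δ := 1 / N with hδ
  have hδ0 : 0 < δ := by positivity
  have hpi := Real.pi_pos
  have hlow : ∀ l, |l| ≤ δ → 4 / η * l ^ 2 ≤ ‖Ψ l‖ := by
    intro l hl
    have h1 := hR.sq_mul_setIntegral_le (N := N) (l := l) (by
      calc |l| * N ≤ δ * N := by gcongr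
        _ = 1 := by rw [hδ]; field_simp)
    refine le_trans ?_ (h1.trans (hR.integral_one_sub_cos_le l))
    calc 4 / η * l ^ 2 = 2 / Real.pi ^ 2 * l ^ 2 * (Real.pi ^ 2 / 2 * (4 / η)) := by field_simp
      _ ≤ _ := by gcongr
  set A₀ := 2 / min 1 (δ ^ 2) with hA₀
  refine ⟨1 / Real.pi * (A₀ * ∫ l, min 1 (l ^ 2) / ‖Ψ l‖), fun x => ?_⟩
  rcases eq_or_ne x 0 with rfl | hx
  · simp only [symmMajorant, mul_zero, Real.cos_zero, sub_self, zero_div, integral_zero, abs_zero,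
      zero_add]
    have : 0 ≤ ∫ l, min 1 (l ^ 2) / ‖Ψ l‖ := integral_nonneg fun l => by positivity
    positivity
  have hpt : ∀ l, (1 - Real.cos (l * x)) / ‖Ψ l‖ ≤
      η * x ^ 2 * (1 + (x * l) ^ 2)⁻¹ + A₀ * (min 1 (l ^ 2) / ‖Ψ l‖) := by
    intro l
    rcases eq_or_ne l 0 with rfl | hl
    · simp
      positivity
    have h0 := hR.norm_exponent_pos hl
    rcases le_or_gt |l| δ with hlδ | hlδ
    · refine le_add_of_le_of_nonneg ?_ (by positivity)
      rw [div_le_iff₀ h0]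
      refine (one_sub_cos_le_div _).trans ?_
      calc 4 * (l * x) ^ 2 * (1 + (l * x) ^ 2)⁻¹
          = η * x ^ 2 * (1 + (x * l) ^ 2)⁻¹ * (4 / η * l ^ 2) := by
            rw [mul_comm x l]; field_simp
        _ ≤ _ := by
            gcongr
            exact hlow l hlδ
    · refine le_add_of_nonneg_of_le (by positivity) ?_
      rw [← mul_div_assoc]
      gcongr
      have h1 : 1 - Real.cos (l * x) ≤ 2 := by linarith [Real.neg_one_le_cos (l * x)]
      refine h1.trans ?_
      have h2 : min 1 (δ ^ 2) ≤ min 1 (l ^ 2) := by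
        refine min_le_min_left _ ?_
        rw [← sq_abs l]
        gcongr
      rw [hA₀, div_mul_eq_mul_div, le_div_iff₀ (by positivity)]
      gcongr
  have hi1 : Integrable fun l => η * x ^ 2 * (1 + (x * l) ^ 2)⁻¹ :=
    (integrable_inv_one_add_sq.comp_mul_left' hx).const_mul _
  have hi2 := hR.integrable_min_div.const_mul A₀
  have h1 : ∫ l : ℝ, (1 - Real.cos (l * x)) / ‖Ψ l‖ ≤
      η * x ^ 2 * (|x⁻¹| * Real.pi) + A₀ * ∫ l, min 1 (l ^ 2) / ‖Ψ l‖ := by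
    refine (integral_mono (hR.integrable_one_sub_cos_div x) (hi1.add hi2) hpt).trans_eq ?_
    simp only [Pi.add_apply]
    rw [integral_add hi1 hi2, integral_const_mul, integral_const_mul,
      Measure.integral_comp_mul_left (fun u : ℝ => (1 + u ^ 2)⁻¹) x, integral_univ_inv_one_add_sq,
      smul_eq_mul]
  calc symmMajorant Ψ x ≤ 1 / Real.pi * (η * x ^ 2 * (|x⁻¹| * Real.pi) +
        A₀ * ∫ l, min 1 (l ^ 2) / ‖Ψ l‖) := by
        unfold symmMajorant
        gcongr
    _ = _ := by
        rw [mul_add]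
        congr 1
        rw [abs_inv, ← sq_abs x]
        have : |x| ≠ 0 := abs_ne_zero.2 hx
        field_simp

end IsResolventFamily

/-- Extraction of a pointwise convergent subsequence from a pointwise bounded, uniformly
equicontinuous sequence. -/
theorem exists_subseq_tendsto_of_equicontinuous {f : ℕ → ℝ → ℝ} {B ω : ℝ → ℝ}
    (hB : ∀ n x, |f n x| ≤ B x) (hω : Tendsto ω (𝓝 0) (𝓝 0))
    (hf : ∀ n x y, |f n x - f n y| ≤ ω (x - y)) :
    ∃ φ : ℕ → ℕ, StrictMono φ ∧ ∃ F : ℝ → ℝ,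
      ∀ x, Tendsto (fun n => f (φ n) x) atTop (𝓝 (F x)) := by
  -- Compactness of a countable product gives convergence at all rationals; the common modulus `ω`
  -- carries it to the reals.
  have hK : IsCompact (Set.pi univ fun a : ℚ => Icc (-B a) (B a)) :=
    isCompact_univ_pi fun _ => isCompact_Icc
  obtain ⟨F₀, -, φ, hφ, hF₀⟩ := hK.tendsto_subseq (x := fun n (a : ℚ) => f n a)
    (fun n a _ => abs_le.1 (hB n a))
  have hrat : ∀ a : ℚ, Tendsto (fun n => f (φ n) a) atTop (𝓝 (F₀ a)) :=
    fun a => (tendsto_pi_nhds.1 hF₀) a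
  refine ⟨φ, hφ, ?_⟩
  have hcau : ∀ x : ℝ, ∃ L, Tendsto (fun n => f (φ n) x) atTop (𝓝 L) := by
    intro x
    refine cauchySeq_tendsto_of_complete (Metric.cauchySeq_iff.2 fun ε hε => ?_)
    obtain ⟨δ, hδ, H⟩ := Metric.eventually_nhds_iff.1
      (hω.eventually (gt_mem_nhds (show (0 : ℝ) < ε / 3 by positivity)))
    obtain ⟨a, ha1, ha2⟩ := exists_rat_btwn (show x < x + δ by linarith)
    have hxa : ω (x - a) < ε / 3 := by
      refine H ?_
      rw [Real.dist_eq, sub_zero, abs_lt]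
      constructor <;> linarith
    obtain ⟨N, hN⟩ := Metric.cauchySeq_iff.1 (hrat a).cauchySeq (ε / 3) (by positivity)
    refine ⟨N, fun m hm n hn => ?_⟩
    have h1 := hN m hm n hn
    have h2 := (hf (φ m) x a).trans_lt hxa
    have h3 := (hf (φ n) x a).trans_lt hxa
    rw [Real.dist_eq] at h1 ⊢
    rw [abs_lt] at h1 h2 h3 ⊢
    constructor <;> linarith [h1.1, h1.2, h2.1, h2.2, h3.1, h3.2]
  choose F hF using hcau
  exact ⟨F, hF⟩

/-! ### Bounded harmonic functions and the equation satisfied by `h_q`. -/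

namespace IsResolventFamily

variable {Ψ : ℝ → ℂ} {r : ℝ → ℝ → ℝ}

theorem integrable_mul_of_bounded (hR : IsResolventFamily Ψ r) {G : ℝ → ℝ} {C : ℝ}
    (hGc : Continuous G) (hC : ∀ x, |G x| ≤ C) : Integrable fun y => r 1 y * G y :=
  (hR.integrable 1 one_pos).mul_bdd (c := C) hGc.aestronglyMeasurable (.of_forall hC)

/-- The increment `d(x) = G(x+a) - G(x)` is itself harmonic. If its supremum `M` were positive,
being near `M` at `x` would force the same at `x+a, x+2a, ...`, and the increments would add up
beyond the bound on `G`. -/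
theorem harmonic_add_le (hR : IsResolventFamily Ψ r) {G : ℝ → ℝ} {C : ℝ}
    (hGu : UniformContinuous G) (hC : ∀ x, |G x| ≤ C)
    (hG : ∀ x, G x = ∫ y, r 1 y * G (x + y)) {a : ℝ} (ha : 0 < r 1 a) (x : ℝ) :
    G (x + a) ≤ G x := by
  have hGc := hGu.continuous
  have hrc := hR.continuous one_pos
  have hrn := hR.nonneg 1 one_pos
  set d : ℝ → ℝ := fun x => G (x + a) - G x with hd
  have hdc : Continuous d := by fun_prop
  have hdC : ∀ x, |d x| ≤ 2 * C := by
    intro x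
    have h1 := abs_le.1 (hC (x + a))
    have h2 := abs_le.1 (hC x)
    rw [abs_le]
    constructor <;> simp only [hd] <;> linarith
  have hdu : UniformContinuous d := by
    refine UniformContinuous.sub (hGu.comp ?_) hGu
    exact uniformContinuous_id.add uniformContinuous_const
  have hdh : ∀ x, d x = ∫ y, r 1 y * d (x + y) := by
    intro x
    simp only [hd]
    rw [hG (x + a), hG x, ← integral_sub]
    · refine integral_congr_ae (.of_forall fun y => ?_)
      simp only
      rw [← mul_sub, show x + a + y = x + y + a by ring]
    · exact hR.integrable_mul_of_bounded (G := fun y => G (x + a + y)) (by fun_prop) fun y => hC _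
    · exact hR.integrable_mul_of_bounded (G := fun y => G (x + y)) (by fun_prop) fun y => hC _
  have hbdd : BddAbove (range d) :=
    ⟨2 * C, by rintro _ ⟨x, rfl⟩; exact (abs_le.1 (hdC x)).2⟩
  set M := sSup (range d) with hM
  have hdM : ∀ x, d x ≤ M := fun x => le_csSup hbdd ⟨x, rfl⟩
  suffices M ≤ 0 by
    have := hdM x
    simp only [hd] at this
    linarith
  by_contra! hMpos
  have step : ∀ η > 0, ∃ θ > 0, ∀ x, M - θ ≤ d x → M - η ≤ d (x + a) := by
    intro η hη
    obtain ⟨ρ₁, hρ₁, H₁⟩ := Metric.uniformContinuous_iff.1 hdu (η / 2) (by positivity)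
    obtain ⟨ρ₂, hρ₂, H₂⟩ := Metric.eventually_nhds_iff.1
      (hrc.continuousAt.eventually (lt_mem_nhds (show r 1 a / 2 < r 1 a by linarith)))
    set ρ := min ρ₁ ρ₂ with hρ
    have hρ0 : 0 < ρ := lt_min hρ₁ hρ₂
    -- If `d(x+a) < M - η`, the deficit `M - d` exceeds `η/2` within `ρ` of `x+a`, where the weight
    -- exceeds `r_1(a)/2`. Averaging over length `2ρ` makes the deficit at `x` at least twice this
    -- `θ`.
    refine ⟨r 1 a / 2 * (η / 2) * ρ, by positivity, fun x hx => ?_⟩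
    by_contra! hlt
    have hball : ∀ y ∈ Ioo (a - ρ) (a + ρ), r 1 a / 2 * (η / 2) ≤ r 1 y * (M - d (x + y)) := by
      intro y hy
      have hya : |y - a| < ρ := abs_lt.2 ⟨by linarith [hy.1], by linarith [hy.2]⟩
      have h1 := H₁ (a := x + y) (b := x + a) (by
        rw [Real.dist_eq, show x + y - (x + a) = y - a by ring]
        exact hya.trans_le (min_le_left _ _))
      have h2 := H₂ (y := y) (by
        rw [Real.dist_eq]
        exact hya.trans_le (min_le_right _ _))
      rw [Real.dist_eq, abs_lt] at h1
      refine mul_le_mul h2.le (by linarith [h1.2]) (by positivity) (hrn y)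
    have hI : Integrable fun y => r 1 y * (M - d (x + y)) :=
      hR.integrable_mul_of_bounded (G := fun y => M - d (x + y)) (C := |M| + 2 * C)
        (by fun_prop) fun y => (abs_sub _ _).trans (add_le_add le_rfl (hdC _))
    have h3 : ∫ y, r 1 y * (M - d (x + y)) = M - d x := by
      simp_rw [mul_sub]
      rw [integral_sub ((hR.integrable 1 one_pos).mul_const M)
        (hR.integrable_mul_of_bounded (G := fun y => d (x + y)) (by fun_prop) fun y => hdC _),
        ← hdh, integral_mul_const, hR.integral_eq one_pos, inv_one, one_mul]
    have h4 : r 1 a / 2 * (η / 2) * (2 * ρ) ≤ ∫ y, r 1 y * (M - d (x + y)) := by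
      calc _ = ∫ y in Ioo (a - ρ) (a + ρ), r 1 a / 2 * (η / 2) := by
            rw [setIntegral_const, Real.volume_real_Ioo_of_le (by linarith), smul_eq_mul]
            ring
        _ ≤ ∫ y in Ioo (a - ρ) (a + ρ), r 1 y * (M - d (x + y)) :=
            setIntegral_mono_on (integrableOn_const (by simp)) hI.integrableOn measurableSet_Ioo
              hball
        _ ≤ _ := setIntegral_le_integral hI (.of_forall fun y =>
            mul_nonneg (hrn y) (sub_nonneg.2 (hdM _)))
    have h5 : 0 < r 1 a / 2 * (η / 2) * ρ := by positivity
    linarith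
  have iter : ∀ k : ℕ, ∀ η > 0, ∃ θ > 0, ∀ x, M - θ ≤ d x → k * (M - η) ≤ G (x + k * a) - G x := by
    intro k
    induction k with
    | zero => exact fun η hη => ⟨1, one_pos, fun x _ => by simp⟩
    | succ k ih =>
      intro η hη
      obtain ⟨θ, hθ, H⟩ := ih η hη
      obtain ⟨θ', hθ', H'⟩ := step θ hθ
      refine ⟨min θ' η, lt_min hθ' hη, fun x hx => ?_⟩
      have h1 := H (x + a) (H' x (by linarith [min_le_left θ' η]))
      have h2 : M - η ≤ d x := by linarith [min_le_right θ' η]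
      have h3 : x + ((k + 1 : ℕ) : ℝ) * a = x + a + k * a := by push_cast; ring
      rw [h3]
      simp only [hd] at h2
      push_cast
      linarith
  obtain ⟨k, hk⟩ := exists_nat_gt (2 * C / (M / 2))
  obtain ⟨θ, hθ, H⟩ := iter k (M / 2) (by positivity)
  obtain ⟨_, ⟨x, rfl⟩, hx⟩ := exists_lt_of_lt_csSup (range_nonempty d)
    (show M - θ < sSup (range d) by linarith)
  have h1 := H x hx.le
  rw [div_lt_iff₀ (by positivity)] at hk
  have h2 := abs_le.1 (hC (x + k * a))
  have h3 := abs_le.1 (hC x)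
  linarith

/-- Choquet–Deny: bounded uniformly continuous harmonic functions are constant. -/
theorem harmonic_eq (hR : IsResolventFamily Ψ r) {G : ℝ → ℝ} {C : ℝ}
    (hGu : UniformContinuous G) (hC : ∀ x, |G x| ≤ C)
    (hG : ∀ x, G x = ∫ y, r 1 y * G (x + y)) (x y : ℝ) : G x = G y := by
  have hrc := hR.continuous one_pos
  have hper : ∀ a, 0 < r 1 a → ∀ x, G (x + a) = G x := by
    intro a ha x
    refine le_antisymm (hR.harmonic_add_le hGu hC hG ha x) ?_
    have := hR.harmonic_add_le (G := fun x => -G x) hGu.neg (fun x => by rw [abs_neg]; exact hC x)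
      (fun x => by simp only [mul_neg, integral_neg]; rw [← hG]) ha x
    linarith
  obtain ⟨ε, hε, H⟩ := Metric.eventually_nhds_iff.1
    (hrc.continuousAt.eventually (lt_mem_nhds (hR.zero_pos one_pos)))
  -- Every small shift is a period, since `r_1 > 0` near `0`.
  have hloc : IsLocallyConstant G := by
    refine (IsLocallyConstant.iff_eventually_eq G).2 fun x => ?_
    filter_upwards [Metric.ball_mem_nhds x hε] with z hz
    rw [← hper (z - x) (H (by rwa [Real.dist_eq, sub_zero, ← Real.dist_eq])) x, add_sub_cancel]
  exact hloc.apply_eq_of_preconnectedSpace x y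

/-- The difference of two resolvent equations between `r_1` and `r_q`, with end points `0` and `-x`.
In this form the integrand stays bounded by `ω(x) r_1(y)` as `q → 0`. -/
theorem diff_eq_add_integral (hR : IsResolventFamily Ψ r) {q : ℝ} (hq : 0 < q) (x : ℝ) :
    resolventDiff r q x = resolventDiff r 1 x +
      (1 - q) * ∫ y, r 1 y * (resolventDiff r q (x + y) - resolventDiff r q y) := by
  have h1 := hR.resolvent_eq one_pos hq 0 0
  have h2 := hR.resolvent_eq one_pos hq 0 (-x)
  obtain ⟨C, hC, hrC⟩ := hR.exists_le hq
  have hrc := hR.continuous hq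
  have hi : ∀ x, Integrable fun y => r 1 (y - 0) * r q (x - y) := by
    intro x
    simp only [sub_zero]
    refine hR.integrable_mul_of_bounded (G := fun y => r q (x - y)) (C := C) (by fun_prop)
      fun y => ?_
    rw [abs_of_nonneg (hR.nonneg q hq _)]
    exact hrC _
  have h3 : ∫ y, r 1 y * (resolventDiff r q (x + y) - resolventDiff r q y) =
      (∫ y, r 1 (y - 0) * r q (0 - y)) - ∫ y, r 1 (y - 0) * r q (-x - y) := by
    rw [← integral_sub (hi _) (hi _)]
    refine integral_congr_ae (.of_forall fun y => ?_)
    simp only [resolventDiff]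
    rw [show -(x + y) = -x - y by ring, sub_zero, zero_sub]
    ring
  rw [h3, mul_sub, h1, h2]
  simp only [resolventDiff, sub_zero]
  ring

end IsResolventFamily

/-- `H` is a pointwise limit of `h_q` along some sequence `q → 0+`. -/
def IsSubseqLimit (r : ℝ → ℝ → ℝ) (H : ℝ → ℝ) : Prop :=
  ∃ u : ℕ → ℝ, (∀ n, 0 < u n) ∧ Tendsto u atTop (𝓝 0) ∧
    ∀ x, Tendsto (fun n => resolventDiff r (u n) x) atTop (𝓝 (H x))

/-! ### Uniqueness of subsequential limits when `∫ x² r_1` is infinite. -/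

namespace IsSubseqLimit

variable {Ψ : ℝ → ℂ} {r : ℝ → ℝ → ℝ} {H H' : ℝ → ℝ}

theorem abs_le (hR : IsResolventFamily Ψ r) (hH : IsSubseqLimit r H) (x : ℝ) :
    |H x| ≤ symmMajorant Ψ x := by
  obtain ⟨u, hu, -, hlim⟩ := hH
  refine le_of_tendsto (hlim x).abs (.of_forall fun n => ?_)
  rw [abs_of_nonneg (hR.diff_nonneg (hu n) x)]
  exact hR.diff_le (hu n) x

theorem abs_sub_le (hR : IsResolventFamily Ψ r) (hH : IsSubseqLimit r H) (x y : ℝ) :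
    |H x - H y| ≤ symmMajorant Ψ (x - y) := by
  obtain ⟨u, hu, -, hlim⟩ := hH
  exact le_of_tendsto ((hlim x).sub (hlim y)).abs
    (.of_forall fun n => hR.abs_diff_sub_le (hu n) x y)

theorem uniformContinuous (hR : IsResolventFamily Ψ r) (hH : IsSubseqLimit r H) :
    UniformContinuous H := by
  refine Metric.uniformContinuous_iff.2 fun ε hε => ?_
  obtain ⟨δ, hδ, h⟩ := Metric.eventually_nhds_iff.1
    (hR.tendsto_symmMajorant.eventually (gt_mem_nhds hε))
  refine ⟨δ, hδ, fun {x y} hxy => ?_⟩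
  rw [Real.dist_eq]
  refine (hH.abs_sub_le hR x y).trans_lt (h ?_)
  rwa [Real.dist_eq, sub_zero, ← Real.dist_eq]

theorem zero (hH : IsSubseqLimit r H) : H 0 = 0 := by
  obtain ⟨u, -, -, hlim⟩ := hH
  refine tendsto_nhds_unique (hlim 0) ?_
  simp [resolventDiff]

theorem eq_add_integral (hR : IsResolventFamily Ψ r) (hH : IsSubseqLimit r H) (x : ℝ) :
    H x = resolventDiff r 1 x + ∫ y, r 1 y * (H (x + y) - H y) := by
  obtain ⟨u, hu, hu0, hlim⟩ := hH
  have hrc := hR.continuous one_pos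
  refine tendsto_nhds_unique (hlim x) ?_
  simp_rw [fun n => hR.diff_eq_add_integral (hu n) x]
  refine tendsto_const_nhds.add ?_
  have h1 : Tendsto (fun n => 1 - u n) atTop (𝓝 1) := by simpa using hu0.const_sub 1
  rw [← one_mul (∫ y, r 1 y * (H (x + y) - H y))]
  refine h1.mul ?_
  refine tendsto_integral_of_dominated_convergence (fun y => r 1 y * symmMajorant Ψ x)
    (fun n => ?_) ((hR.integrable 1 one_pos).mul_const _) (fun n => .of_forall fun y => ?_)
    (.of_forall fun y => ((hlim (x + y)).sub (hlim y)).const_mul _)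
  · have := hR.continuous (hu n)
    unfold resolventDiff
    exact Continuous.aestronglyMeasurable (by fun_prop)
  · rw [norm_mul, Real.norm_eq_abs, abs_of_nonneg (hR.nonneg 1 one_pos y), Real.norm_eq_abs]
    refine mul_le_mul_of_nonneg_left ?_ (hR.nonneg 1 one_pos y)
    have := hR.abs_diff_sub_le (hu n) (x + y) y
    rwa [add_sub_cancel_right] at this

theorem integrable (hR : IsResolventFamily Ψ r) (hH : IsSubseqLimit r H) (x z : ℝ) :
    Integrable fun y => r 1 y * (H (x + y) - H (z + y)) := by
  have hc := (hH.uniformContinuous hR).continuous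
  refine hR.integrable_mul_of_bounded (G := fun y => H (x + y) - H (z + y))
    (C := symmMajorant Ψ (x - z)) (by fun_prop) fun y => ?_
  have := hH.abs_sub_le hR (x + y) (z + y)
  rwa [add_sub_add_right_eq_sub] at this

theorem sub_eq_integral (hR : IsResolventFamily Ψ r) (hH : IsSubseqLimit r H) (x z : ℝ) :
    H x - H z = resolventDiff r 1 x - resolventDiff r 1 z +
      ∫ y, r 1 y * (H (x + y) - H (z + y)) := by
  rw [hH.eq_add_integral hR x, hH.eq_add_integral hR z]
  have h1 : ∫ y, r 1 y * (H (x + y) - H (z + y)) =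
      (∫ y, r 1 y * (H (x + y) - H y)) - ∫ y, r 1 y * (H (z + y) - H y) := by
    rw [← integral_sub (by simpa using hH.integrable hR x 0) (by simpa using hH.integrable hR z 0)]
    refine integral_congr_ae (.of_forall fun y => ?_)
    simp only
    ring
  rw [h1]
  ring

/-- In the difference of the two limit equations the term `h_1` cancels, so the increments of `g = H
- H'` are harmonic, and bounded by `2ω(a)`. Choquet–Deny makes `g` additive. -/
theorem eq (hR : IsResolventFamily Ψ r) (hinf : ¬ Integrable fun x => x ^ 2 * r 1 x)
    (hH : IsSubseqLimit r H) (hH' : IsSubseqLimit r H') : H = H' := by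
  set g : ℝ → ℝ := fun x => H x - H' x with hg
  have hgu : UniformContinuous g := (hH.uniformContinuous hR).sub (hH'.uniformContinuous hR)
  have hadd : ∀ x a, g (x + a) = g x + g a := by
    intro x a
    have h1 := hR.harmonic_eq (G := fun x => g (x + a) - g x) (C := 2 * symmMajorant Ψ a)
      ((hgu.comp (uniformContinuous_id.add uniformContinuous_const)).sub hgu) (fun x => ?_)
      (fun x => ?_) x 0
    · simp only [zero_add, hg, hH.zero, hH'.zero, sub_zero] at h1 ⊢
      linarith
    · have h2 := _root_.abs_le.1 (hH.abs_sub_le hR (x + a) x)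
      have h3 := _root_.abs_le.1 (hH'.abs_sub_le hR (x + a) x)
      rw [add_sub_cancel_left] at h2 h3
      rw [_root_.abs_le]
      constructor <;> simp only [hg] <;> linarith [h2.1, h2.2, h3.1, h3.2]
    · have h2 := hH.sub_eq_integral hR (x + a) x
      have h3 := hH'.sub_eq_integral hR (x + a) x
      have h4 : ∫ y, r 1 y * (g (x + y + a) - g (x + y)) =
          (∫ y, r 1 y * (H (x + a + y) - H (x + y))) -
            ∫ y, r 1 y * (H' (x + a + y) - H' (x + y)) := by
        rw [← integral_sub (hH.integrable hR _ _) (hH'.integrable hR _ _)]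
        refine integral_congr_ae (.of_forall fun y => ?_)
        simp only [hg]
        rw [show x + y + a = x + a + y by ring]
        ring
      rw [h4]
      simp only [hg]
      linarith
  have hnat : ∀ (n : ℕ) x, g (n * x) = n * g x := by
    intro n x
    induction n with
    | zero => simp [hg, hH.zero, hH'.zero]
    | succ n ih =>
      push_cast
      rw [add_mul, one_mul, hadd, ih]
      ring
  ext x
  suffices g x = 0 by
    simp only [hg] at this
    linarith
  -- Additivity gives `n |g(x)| = |g(nx)| ≤ 2ω(nx) ≤ 2(ηn|x| + A)`; then `n → ∞`.
  have hsmall : ∀ η > 0, |g x| ≤ 2 * (η * |x|) := by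
    intro η hη
    obtain ⟨A, hA⟩ := hR.exists_symmMajorant_le hinf hη
    have hb : ∀ n : ℕ, |g x| * n ≤ 2 * (η * |x|) * n + 2 * A := by
      intro n
      have h1 : |g (n * x)| ≤ 2 * symmMajorant Ψ (n * x) := by
        have h2 := _root_.abs_le.1 (hH.abs_le hR (n * x))
        have h3 := _root_.abs_le.1 (hH'.abs_le hR (n * x))
        rw [_root_.abs_le]
        constructor <;> simp only [hg] <;> linarith [h2.1, h2.2, h3.1, h3.2]
      have h4 := hA (n * x)
      rw [hnat, abs_mul, Nat.abs_cast] at h1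
      rw [abs_mul, Nat.abs_cast] at h4
      nlinarith
    by_contra! hlt
    obtain ⟨n, hn⟩ := exists_nat_gt (2 * A / (|g x| - 2 * (η * |x|)))
    rw [div_lt_iff₀ (sub_pos.2 hlt)] at hn
    have := hb n
    nlinarith
  have h0 : |g x| ≤ 0 := by
    refine le_of_forall_pos_le_add fun ε hε => ?_
    have h1 := hsmall (ε / (2 * (|x| + 1))) (by positivity)
    refine h1.trans ?_
    rw [zero_add]
    have : 2 * (ε / (2 * (|x| + 1)) * |x|) = ε * (|x| / (|x| + 1)) := by field_simp
    rw [this]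
    exact mul_le_of_le_one_right hε.le (div_le_one_of_le₀ (by linarith) (by positivity))
  exact abs_nonpos_iff.1 h0

end IsSubseqLimit

namespace IsResolventFamily

variable {Ψ : ℝ → ℂ} {r : ℝ → ℝ → ℝ}

theorem exists_subseqLimit (hR : IsResolventFamily Ψ r) {u : ℕ → ℝ}
    (hu : Tendsto u atTop (𝓝[>] 0)) :
    ∃ φ : ℕ → ℕ, ∃ H, IsSubseqLimit r H ∧
      ∀ x, Tendsto (fun n => resolventDiff r (u (φ n)) x) atTop (𝓝 (H x)) := by
  obtain ⟨hu0, hupos⟩ := tendsto_nhdsWithin_iff.1 hu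
  obtain ⟨N, hN⟩ := eventually_atTop.1 hupos
  obtain ⟨φ, hφ, H, hH⟩ := exists_subseq_tendsto_of_equicontinuous
    (f := fun n => resolventDiff r (u (n + N))) (B := symmMajorant Ψ)
    (fun n x => by
      rw [abs_of_nonneg (hR.diff_nonneg (hN _ (by omega)) x)]
      exact hR.diff_le (hN _ (by omega)) x) hR.tendsto_symmMajorant
    (fun n x y => hR.abs_diff_sub_le (hN _ (by omega)) x y)
  refine ⟨fun n => φ n + N, H, ⟨fun n => u (φ n + N), fun n => hN _ (by omega), ?_, hH⟩, hH⟩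
  exact hu0.comp ((tendsto_add_atTop_nat N).comp hφ.tendsto_atTop)

theorem exists_limit_of_not_integrable (hR : IsResolventFamily Ψ r)
    (hinf : ¬ Integrable fun x => x ^ 2 * r 1 x) :
    ∃ H : ℝ → ℝ, ∀ x, Tendsto (fun q => resolventDiff r q x) (𝓝[>] 0) (𝓝 (H x)) := by
  obtain ⟨u, hu⟩ := exists_seq_tendsto (𝓝[>] (0 : ℝ))
  obtain ⟨-, H, hH, -⟩ := hR.exists_subseqLimit hu
  refine ⟨H, fun x => tendsto_of_subseq_tendsto fun v hv => ?_⟩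
  obtain ⟨φ, H', hH', hlim⟩ := hR.exists_subseqLimit hv
  refine ⟨φ, ?_⟩
  rw [hH.eq hR hinf hH']
  exact hlim x

end IsResolventFamily

/-! ### Finite `∫ x² r_1`: the first moment vanishes. -/

theorem abs_sin_sub_le (u : ℝ) : |Real.sin u - u| ≤ 4 * |u| ^ 3 * (1 + u ^ 2)⁻¹ := by
  rw [← div_eq_mul_inv, le_div_iff₀ (by positivity), ← sq_abs u]
  have h2 : |Real.sin u - u| ≤ 2 * |u| := by
    have := (abs_sub (Real.sin u) u).trans (add_le_add (Real.abs_sin_le_abs (x := u)) le_rfl)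
    linarith
  have h0 := abs_nonneg u
  rcases le_or_gt |u| 1 with h | h
  · have h1 : |Real.sin u - u| ≤ |u| ^ 3 := by
      have h3 := Real.abs_sub_sin_le u
      rw [abs_sub_comm] at h3
      linarith [pow_nonneg h0 3]
    have h3 : |u| ^ 2 ≤ 1 := by nlinarith
    nlinarith [pow_nonneg h0 3]
  · have h3 : 1 ≤ |u| ^ 2 := by nlinarith
    nlinarith [pow_nonneg h0 3]

theorem abs_sin_sub_le_sq (u : ℝ) : |Real.sin u - u| ≤ 2 * u ^ 2 := by
  refine (abs_sin_sub_le u).trans ?_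
  rw [← div_eq_mul_inv, div_le_iff₀ (by positivity), ← sq_abs u]
  nlinarith [abs_nonneg u, sq_nonneg (|u| * (|u| - 1)), sq_nonneg (|u| - 1),
    mul_nonneg (sq_nonneg |u|) (sq_nonneg (|u| - 1))]

namespace IsResolventFamily

variable {Ψ : ℝ → ℂ} {r : ℝ → ℝ → ℝ}

theorem integral_sin (hR : IsResolventFamily Ψ r) (l : ℝ) :
    ∫ x, Real.sin (l * x) * r 1 x = ((1 + Ψ l)⁻¹).im := by
  have h1 := hR.fourier 1 one_pos l
  have hi := hR.integrable 1 one_pos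
  have hi2 : Integrable fun x : ℝ => Complex.exp (Complex.I * l * x) * (r 1 x : ℂ) := by
    refine (hi.ofReal (𝕜 := ℂ)).bdd_mul (c := 1) (by fun_prop) (.of_forall fun x => ?_)
    rw [Complex.norm_exp]
    simp
  rw [← Complex.ofReal_one, ← h1]
  refine Eq.trans ?_ (integral_im hi2)
  refine integral_congr_ae (.of_forall fun x => ?_)
  change _ = Complex.im _
  rw [Complex.im_mul_ofReal, Complex.exp_im]
  simp

theorem normSq_one_add_pos (hR : IsResolventFamily Ψ r) (l : ℝ) :
    0 < Complex.normSq (1 + Ψ l) := by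
  rw [Complex.normSq_pos]
  simpa using hR.add_ne_zero one_pos l

theorem abs_im_exponent (hR : IsResolventFamily Ψ r) (l : ℝ) :
    |(Ψ l).im| = |((1 + Ψ l)⁻¹).im| * Complex.normSq (1 + Ψ l) := by
  have h := hR.normSq_one_add_pos l
  rw [Complex.inv_im, abs_div, abs_neg, abs_of_pos h, div_mul_cancel₀ _ h.ne']
  simp

/-- The right side equals `Re Ψ + |Ψ|²`. -/
theorem re_exponent_le (hR : IsResolventFamily Ψ r) (l : ℝ) :
    (Ψ l).re ≤ (∫ x, (1 - Real.cos (l * x)) * r 1 x) * Complex.normSq (1 + Ψ l) := by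
  have h := hR.normSq_one_add_pos l
  have h2 := hR.re_nonneg l
  rw [hR.integral_one_sub_cos, Complex.inv_re, sub_mul, div_mul_cancel₀ _ h.ne', one_mul,
    Complex.normSq_apply]
  simp
  nlinarith [sq_nonneg (Ψ l).im, sq_nonneg (Ψ l).re]

theorem exists_normSq_le (hR : IsResolventFamily Ψ r) :
    ∃ δ, 0 < δ ∧ δ ≤ 1 ∧ ∀ l, |l| ≤ δ → Complex.normSq (1 + Ψ l) ≤ 2 := by
  have hc := hR.continuous_exponent
  have h1 : Continuous fun l => Complex.normSq (1 + Ψ l) :=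
    Complex.continuous_normSq.comp (by fun_prop)
  have h2 := h1.continuousAt (x := 0) |>.eventually
    (gt_mem_nhds (show Complex.normSq (1 + Ψ 0) < 2 by rw [hR.exponent_zero]; simp))
  obtain ⟨ε, hε, H⟩ := Metric.eventually_nhds_iff.1 h2
  refine ⟨min (ε / 2) 1, by positivity, min_le_right _ _, fun l hl => (H ?_).le⟩
  rw [Real.dist_eq, sub_zero]
  linarith [min_le_left (ε / 2) (1 : ℝ)]

theorem inv_norm_le {δ l : ℝ} (hδ : 0 < δ) (hl : δ < |l|) :
    ‖Ψ l‖⁻¹ ≤ (min 1 (δ ^ 2))⁻¹ * (min 1 (l ^ 2) / ‖Ψ l‖) := by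
  have h2 : min 1 (δ ^ 2) ≤ min 1 (l ^ 2) := by
    refine min_le_min_left _ ?_
    rw [← sq_abs l]
    gcongr
  have h3 : 0 < min 1 (δ ^ 2) := by positivity
  rw [div_eq_mul_inv, ← mul_assoc]
  refine le_mul_of_one_le_left (by positivity) ?_
  rw [← div_eq_inv_mul, le_div_iff₀ h3]
  linarith

theorem integrable_mul_of_sq (hR : IsResolventFamily Ψ r)
    (hfin : Integrable fun x => x ^ 2 * r 1 x) : Integrable fun x => x * r 1 x := by
  have hc := hR.continuous one_pos
  refine (hfin.add (hR.integrable 1 one_pos)).mono' (by fun_prop) (.of_forall fun x => ?_)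
  have h := hR.nonneg 1 one_pos x
  rw [norm_mul, Real.norm_eq_abs, Real.norm_eq_abs, abs_of_nonneg h, Pi.add_apply]
  have h1 : |x| ≤ x ^ 2 + 1 := by
    rw [← sq_abs]
    nlinarith [sq_nonneg (|x| - 1), abs_nonneg x]
  nlinarith

theorem integrable_abs_sin_sub (hR : IsResolventFamily Ψ r)
    (hfin : Integrable fun x => x ^ 2 * r 1 x) (l : ℝ) :
    Integrable fun x => |Real.sin (l * x) - l * x| * r 1 x := by
  have hc := hR.continuous one_pos
  refine (hfin.const_mul (2 * l ^ 2)).mono' (by fun_prop) (.of_forall fun x => ?_)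
  have h := hR.nonneg 1 one_pos x
  rw [norm_mul, Real.norm_eq_abs, Real.norm_eq_abs, abs_of_nonneg h, abs_abs, ← mul_assoc]
  refine mul_le_mul_of_nonneg_right ?_ h
  have := abs_sin_sub_le_sq (l * x)
  linarith

theorem abs_im_sub_le (hR : IsResolventFamily Ψ r)
    (hfin : Integrable fun x => x ^ 2 * r 1 x) (l : ℝ) :
    |((1 + Ψ l)⁻¹).im - l * ∫ x, x * r 1 x| ≤ ∫ x, |Real.sin (l * x) - l * x| * r 1 x := by
  have hc := hR.continuous one_pos
  have hi : Integrable fun x => Real.sin (l * x) * r 1 x :=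
    (hR.integrable 1 one_pos).bdd_mul (c := 1) (by fun_prop)
      (.of_forall fun x => Real.abs_sin_le_one _)
  rw [← hR.integral_sin, ← integral_const_mul,
    ← integral_sub hi ((hR.integrable_mul_of_sq hfin).const_mul l)]
  refine (abs_integral_le_integral_abs).trans_eq ?_
  refine integral_congr_ae (.of_forall fun x => ?_)
  simp only
  rw [← mul_assoc, ← sub_mul, abs_mul, abs_of_nonneg (hR.nonneg 1 one_pos x)]

theorem re_inv_le_inv_norm (hR : IsResolventFamily Ψ r) {q l : ℝ} (hq : 0 ≤ q) (hl : l ≠ 0) :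
    (((q : ℂ) + Ψ l)⁻¹).re ≤ ‖Ψ l‖⁻¹ := by
  refine (Complex.re_le_norm _).trans ?_
  rw [norm_inv]
  exact inv_anti₀ (hR.norm_exponent_pos hl) (hR.norm_le_norm_add hq l)

/-- If the resolvent densities blow up at the origin, the first moment vanishes. -/
theorem first_moment_eq_zero (hR : IsResolventFamily Ψ r)
    (hfin : Integrable fun x => x ^ 2 * r 1 x) (hrec : ∀ C, ∃ q, 0 < q ∧ C < r q 0) :
    ∫ x, x * r 1 x = 0 := by
  by_contra hμ
  set μ := ∫ x, x * r 1 x with hμ_def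
  set S := ∫ x, x ^ 2 * r 1 x with hS
  have hS0 : 0 ≤ S := integral_nonneg fun x => mul_nonneg (sq_nonneg x) (hR.nonneg 1 one_pos x)
  have hμ0 : 0 < |μ| := abs_pos.2 hμ
  obtain ⟨δ₁, hδ₁, hδ₁1, H₁⟩ := hR.exists_normSq_le
  -- For `|l| ≤ δ` the error `2S l²` in `Im 1/(1+Ψ) ≈ μl` is at most half of `|μl|`, which gives
  -- `|Im Ψ| ≥ c|l|` with `c = |μ|/2`.
  set δ := min δ₁ (|μ| / (4 * S + 1)) with hδ
  have hδ0 : 0 < δ := by positivity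
  set c := |μ| / 2 with hc
  have hc0 : 0 < c := by positivity
  have hre : ∀ l, |l| ≤ δ → (Ψ l).re ≤ S * l ^ 2 := by
    intro l hl
    have h1 := hR.re_exponent_le l
    have h2 : ∫ x, (1 - Real.cos (l * x)) * r 1 x ≤ S * l ^ 2 / 2 := by
      rw [mul_div_assoc, hS, ← integral_mul_const]
      refine integral_mono (hR.integrable_one_sub_cos l) (hfin.mul_const _) fun x => ?_
      simp only
      have := mul_le_mul_of_nonneg_right (one_sub_cos_le_sq (l * x)) (hR.nonneg 1 one_pos x)
      linarith
    have h3 := H₁ l (hl.trans (min_le_left _ _))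
    have h4 := (hR.normSq_one_add_pos l).le
    have h5 : 0 ≤ S * l ^ 2 / 2 := by positivity
    calc _ ≤ _ := h1
      _ ≤ S * l ^ 2 / 2 * 2 := by gcongr
      _ = _ := by ring
  have him : ∀ l, |l| ≤ δ → c ^ 2 * l ^ 2 ≤ (Ψ l).im ^ 2 := by
    intro l hl
    have h1 := hR.abs_im_sub_le hfin l
    have h2 : ∫ x, |Real.sin (l * x) - l * x| * r 1 x ≤ S * (2 * l ^ 2) := by
      rw [hS, ← integral_mul_const]
      refine integral_mono (hR.integrable_abs_sin_sub hfin l) (hfin.mul_const _) fun x => ?_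
      simp only
      have := mul_le_mul_of_nonneg_right (abs_sin_sub_le_sq (l * x)) (hR.nonneg 1 one_pos x)
      linarith
    have h3 : |l| * |μ| - |((1 + Ψ l)⁻¹).im| ≤ S * (2 * l ^ 2) := by
      rw [← abs_mul]
      refine le_trans ?_ (h1.trans h2)
      rw [abs_sub_comm]
      exact abs_sub_abs_le_abs_sub _ _
    have h4 : |((1 + Ψ l)⁻¹).im| ≤ |(Ψ l).im| := by
      rw [hR.abs_im_exponent]
      refine le_mul_of_one_le_right (abs_nonneg _) ?_
      rw [Complex.normSq_eq_norm_sq]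
      have := hR.one_le_norm_add l
      nlinarith
    have h5 : S * (2 * l ^ 2) ≤ |l| * c := by
      have h6 : |l| * (4 * S + 1) ≤ |μ| := by
        rw [← le_div_iff₀ (by positivity)]
        exact hl.trans (min_le_right _ _)
      rw [← sq_abs, hc]
      nlinarith [abs_nonneg l]
    have h6 : c * |l| ≤ |(Ψ l).im| := by
      rw [hc] at h5 ⊢
      linarith
    calc c ^ 2 * l ^ 2 = (c * |l|) ^ 2 := by rw [mul_pow, sq_abs]
      _ ≤ |(Ψ l).im| ^ 2 := by gcongr
      _ = _ := sq_abs _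
  set K := S / c ^ 2 * 2 with hK
  set A₀ := (min 1 (δ ^ 2))⁻¹ with hA₀
  have hA₀0 : 0 < A₀ := by positivity
  -- Near `0`, `|q+Ψ|² ≥ q² + c²l²`. So `q/|q+Ψ|²` lies below a Cauchy kernel of integral `π/c`,
  -- independent of `q`, and `Re Ψ/|q+Ψ|² ≤ S/c²`. The factor `2` in `K` comes from `1 ≤ 2/(1+l²)`
  -- for `|l| ≤ 1`. This bounds `r_q(0)` uniformly in `q`.
  have hpt : ∀ q : ℝ, 0 < q → ∀ l : ℝ, l ≠ 0 → (((q : ℂ) + Ψ l)⁻¹).re ≤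
      q⁻¹ * (1 + (c / q * l) ^ 2)⁻¹ + K * (1 + l ^ 2)⁻¹ + A₀ * (min 1 (l ^ 2) / ‖Ψ l‖) := by
    intro q hq l hl0
    have hK0 : 0 ≤ K := by positivity
    rcases le_or_gt |l| δ with hl | hl
    · refine le_add_of_le_of_nonneg ?_ (by positivity)
      have h1 := hre l hl
      have h2 := him l hl
      have h3 := hR.re_nonneg l
      have hl2 : 0 < l ^ 2 := by positivity
      have hden : 0 < c ^ 2 * l ^ 2 := by positivity
      have hn : q ^ 2 + c ^ 2 * l ^ 2 ≤ Complex.normSq ((q : ℂ) + Ψ l) := by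
        rw [Complex.normSq_apply]
        simp
        nlinarith
      have hsq : l ^ 2 ≤ 1 := by
        rw [sq_le_one_iff_abs_le_one]
        exact hl.trans ((min_le_left _ _).trans hδ₁1)
      rw [Complex.inv_re, Complex.add_re, Complex.ofReal_re, add_div]
      refine add_le_add ?_ ?_
      · calc q / Complex.normSq ((q : ℂ) + Ψ l) ≤ q / (q ^ 2 + c ^ 2 * l ^ 2) := by gcongr
          _ = _ := by field_simp
      · calc (Ψ l).re / Complex.normSq ((q : ℂ) + Ψ l) ≤ S * l ^ 2 / (c ^ 2 * l ^ 2) := by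
              refine div_le_div₀ (by positivity) h1 hden (by nlinarith)
          _ = S / c ^ 2 * 1 := by field_simp
          _ ≤ S / c ^ 2 * (2 * (1 + l ^ 2)⁻¹) := by
              gcongr
              rw [← div_eq_mul_inv, le_div_iff₀ (by positivity)]
              linarith
          _ = _ := by rw [hK]; ring
    · refine le_add_of_nonneg_of_le (by positivity) ?_
      exact (hR.re_inv_le_inv_norm hq.le hl0).trans (inv_norm_le hδ0 hl)
  obtain ⟨q, hq, hlt⟩ := hrec ((1 / (2 * Real.pi)) *
    (c⁻¹ * Real.pi + K * Real.pi + A₀ * ∫ l, min 1 (l ^ 2) / ‖Ψ l‖))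
  refine hlt.not_ge ?_
  rw [hR.inversion q hq]
  refine mul_le_mul_of_nonneg_left ?_ (by positivity)
  have hcq : c / q ≠ 0 := by positivity
  have i1 : Integrable fun l : ℝ => q⁻¹ * (1 + (c / q * l) ^ 2)⁻¹ :=
    (integrable_inv_one_add_sq.comp_mul_left' hcq).const_mul _
  have i2 : Integrable fun l : ℝ => K * (1 + l ^ 2)⁻¹ := integrable_inv_one_add_sq.const_mul _
  have i12 : Integrable fun l : ℝ => q⁻¹ * (1 + (c / q * l) ^ 2)⁻¹ + K * (1 + l ^ 2)⁻¹ := i1.add i2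
  have i3 := hR.integrable_min_div.const_mul A₀
  have e1 : ∫ l : ℝ, (q⁻¹ * (1 + (c / q * l) ^ 2)⁻¹ + K * (1 + l ^ 2)⁻¹ +
      A₀ * (min 1 (l ^ 2) / ‖Ψ l‖)) =
      c⁻¹ * Real.pi + K * Real.pi + A₀ * ∫ l, min 1 (l ^ 2) / ‖Ψ l‖ := by
    rw [integral_add i12 i3, integral_add i1 i2, integral_const_mul, integral_const_mul,
      integral_const_mul,
      Measure.integral_comp_mul_left (fun u : ℝ => (1 + u ^ 2)⁻¹) (c / q),
      integral_univ_inv_one_add_sq, smul_eq_mul, abs_of_pos (by positivity)]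
    congr 2
    field_simp
  rw [← e1]
  refine integral_mono_ae (hR.integrable_phase_re hq 0) (i12.add i3) ?_
  filter_upwards [compl_mem_ae_iff.2 (measure_singleton (0 : ℝ))] with l hl
  have := hpt q hq l hl
  simpa using this

end IsResolventFamily

/-! ### Finite `∫ x² r_1`: dominated convergence and the integral formula. -/

namespace IsResolventFamily

variable {Ψ : ℝ → ℂ} {r : ℝ → ℝ → ℝ}

/-- Integrating in `l` first turns `4|x|³/(1+(xl)²)` into `4πx²`, so a finite second moment is
exactly what is required. -/
theorem integrable_cube_div_prod (hR : IsResolventFamily Ψ r)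
    (hfin : Integrable fun x => x ^ 2 * r 1 x) :
    Integrable (fun z : ℝ × ℝ => 4 * |z.2| ^ 3 * (1 + (z.2 * z.1) ^ 2)⁻¹ * r 1 z.2)
      (volume.prod volume) := by
  have hc := hR.continuous one_pos
  have hcont : Continuous fun z : ℝ × ℝ => 4 * |z.2| ^ 3 * (1 + (z.2 * z.1) ^ 2)⁻¹ * r 1 z.2 := by
    have : ∀ z : ℝ × ℝ, 1 + (z.2 * z.1) ^ 2 ≠ 0 := fun z => by positivity
    fun_prop (disch := assumption)
  have hnn : ∀ z : ℝ × ℝ, 0 ≤ 4 * |z.2| ^ 3 * (1 + (z.2 * z.1) ^ 2)⁻¹ * r 1 z.2 := fun z =>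
    mul_nonneg (by positivity) (hR.nonneg 1 one_pos _)
  have hint : ∀ x : ℝ, Integrable fun l : ℝ => 4 * |x| ^ 3 * (1 + (x * l) ^ 2)⁻¹ * r 1 x := by
    intro x
    rcases eq_or_ne x 0 with rfl | hx
    · simp
    · exact ((integrable_inv_one_add_sq.comp_mul_left' hx).const_mul _).mul_const _
  rw [integrable_prod_iff' hcont.aestronglyMeasurable]
  refine ⟨.of_forall hint, (hfin.const_mul (4 * Real.pi)).congr (.of_forall fun x => ?_)⟩
  simp only
  simp_rw [fun l : ℝ => (Real.norm_eq_abs _).trans (abs_of_nonneg (hnn (l, x)))]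
  rw [integral_mul_const, integral_const_mul]
  rcases eq_or_ne x 0 with rfl | hx
  · simp
  rw [Measure.integral_comp_mul_left (fun u : ℝ => (1 + u ^ 2)⁻¹) x, integral_univ_inv_one_add_sq,
    smul_eq_mul, abs_inv, ← sq_abs x]
  have : |x| ≠ 0 := abs_ne_zero.2 hx
  field_simp

theorem integrable_cube_div (hR : IsResolventFamily Ψ r)
    (hfin : Integrable fun x => x ^ 2 * r 1 x) {l : ℝ} (hl : l ≠ 0) :
    Integrable fun x => 4 * |x| ^ 3 * (1 + (x * l) ^ 2)⁻¹ * r 1 x := by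
  have hc := hR.continuous one_pos
  have hcont : Continuous fun x : ℝ => 4 * |x| ^ 3 * (1 + (x * l) ^ 2)⁻¹ * r 1 x := by
    have : ∀ x : ℝ, 1 + (x * l) ^ 2 ≠ 0 := fun z => by positivity
    fun_prop (disch := assumption)
  refine ((hR.integrable_mul_of_sq hfin).norm.const_mul (4 / l ^ 2)).mono'
    hcont.aestronglyMeasurable (.of_forall fun x => ?_)
  have h := hR.nonneg 1 one_pos x
  have hl2 : 0 < l ^ 2 := by positivity
  rw [Real.norm_eq_abs, abs_of_nonneg (by positivity), norm_mul, Real.norm_eq_abs,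
    Real.norm_eq_abs, abs_of_nonneg h, ← mul_assoc]
  refine mul_le_mul_of_nonneg_right ?_ h
  rw [← div_eq_mul_inv, div_mul_eq_mul_div, div_le_div_iff₀ (by positivity) hl2,
    mul_pow, ← sq_abs x]
  nlinarith [abs_nonneg x, pow_nonneg (abs_nonneg x) 3]

/-- With vanishing first moment, `Im Ψ` is small near the origin in an integrated sense. -/
theorem exists_abs_im_le (hR : IsResolventFamily Ψ r)
    (hfin : Integrable fun x => x ^ 2 * r 1 x) (hμ : ∫ x, x * r 1 x = 0) :
    ∃ W : ℝ → ℝ, Integrable W ∧ (∀ l, 0 ≤ W l) ∧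
      ∀ l, l ≠ 0 → |(Ψ l).im| ≤ |l| ^ 3 * W l * Complex.normSq (1 + Ψ l) := by
  refine ⟨fun l => ∫ x, 4 * |x| ^ 3 * (1 + (x * l) ^ 2)⁻¹ * r 1 x,
    (hR.integrable_cube_div_prod hfin).integral_prod_left, fun l => integral_nonneg fun x =>
      mul_nonneg (by positivity) (hR.nonneg 1 one_pos _), fun l hl => ?_⟩
  rw [hR.abs_im_exponent]
  refine mul_le_mul_of_nonneg_right ?_ (hR.normSq_one_add_pos l).le
  have h1 := hR.abs_im_sub_le hfin l
  rw [hμ, mul_zero, sub_zero] at h1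
  refine h1.trans ?_
  simp only
  rw [← integral_const_mul]
  refine integral_mono (hR.integrable_abs_sin_sub hfin l)
    ((hR.integrable_cube_div hfin hl).const_mul _) fun x => ?_
  simp only
  rw [← mul_assoc]
  refine mul_le_mul_of_nonneg_right ?_ (hR.nonneg 1 one_pos x)
  refine (abs_sin_sub_le _).trans_eq ?_
  rw [abs_mul, mul_comm l x]
  ring

theorem abs_im_inv_le (hR : IsResolventFamily Ψ r) {q l : ℝ} (hq : 0 ≤ q) (hl : l ≠ 0) :
    |(((q : ℂ) + Ψ l)⁻¹).im| ≤ |(Ψ l).im| / ‖Ψ l‖ ^ 2 := by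
  have h0 := hR.norm_exponent_pos hl
  have h1 := hR.norm_le_norm_add hq l
  rw [Complex.inv_im, abs_div, abs_neg, Complex.normSq_eq_norm_sq,
    abs_of_nonneg (sq_nonneg ‖(q : ℂ) + Ψ l‖)]
  simp only [Complex.add_im, Complex.ofReal_im, zero_add]
  gcongr

/-- The cosine part is dominated by `(1 - cos)/|Ψ|`. The sine part needs the smallness of `Im Ψ`
near `0`. Including `q = 0` also gives absolute convergence of the limiting integral. -/
theorem exists_bound (hR : IsResolventFamily Ψ r)
    (hfin : Integrable fun x => x ^ 2 * r 1 x) (hμ : ∫ x, x * r 1 x = 0) (x : ℝ) :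
    ∃ b : ℝ → ℝ, Integrable b ∧ ∀ q : ℝ, 0 ≤ q → ∀ l : ℝ, l ≠ 0 →
      |((1 - Complex.exp (Complex.I * l * x)) / ((q : ℂ) + Ψ l)).re| ≤ b l := by
  obtain ⟨W, hW, hW0, HW⟩ := hR.exists_abs_im_le hfin hμ
  obtain ⟨δ, hδ, hδ1, Hδ⟩ := hR.exists_normSq_le
  obtain ⟨c, hc, Hc⟩ := hR.exists_mul_min_le
  set A₀ := (min 1 (δ ^ 2))⁻¹ with hA₀
  refine ⟨fun l => (1 - Real.cos (l * x)) / ‖Ψ l‖ + (2 * |x| / c ^ 2 * W l +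
    A₀ * (min 1 (l ^ 2) / ‖Ψ l‖)), (hR.integrable_one_sub_cos_div x).add
      ((hW.const_mul _).add (hR.integrable_min_div.const_mul _)), fun q hq l hl => ?_⟩
  have h0 := hR.norm_exponent_pos hl
  have e : ((1 - Complex.exp (Complex.I * l * x)) / ((q : ℂ) + Ψ l)).re =
      (1 - Real.cos (l * x)) * (((q : ℂ) + Ψ l)⁻¹).re +
        Real.sin (l * x) * (((q : ℂ) + Ψ l)⁻¹).im := by
    rw [div_eq_mul_inv, Complex.mul_re, Complex.sub_re, Complex.sub_im, Complex.exp_re,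
      Complex.exp_im]
    simp
  rw [e]
  refine (abs_add_le _ _).trans (add_le_add ?_ ?_)
  · rw [abs_mul, abs_of_nonneg (one_sub_cos_nonneg _), div_eq_mul_inv]
    refine mul_le_mul_of_nonneg_left ?_ (one_sub_cos_nonneg _)
    refine (Complex.abs_re_le_norm _).trans ?_
    rw [norm_inv]
    exact inv_anti₀ h0 (hR.norm_le_norm_add hq l)
  · rw [abs_mul]
    have h1 := hR.abs_im_inv_le hq hl
    have hm : 0 ≤ A₀ * (min 1 (l ^ 2) / ‖Ψ l‖) := by positivity
    have hw : 0 ≤ 2 * |x| / c ^ 2 * W l := mul_nonneg (by positivity) (hW0 l)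
    rcases le_or_gt |l| δ with hlδ | hlδ
    · refine le_add_of_le_of_nonneg ?_ hm
      have hsq : l ^ 2 ≤ 1 := by
        rw [sq_le_one_iff_abs_le_one]
        exact hlδ.trans hδ1
      have h2 : c * l ^ 2 ≤ ‖Ψ l‖ := by
        have := (Hc l).trans (hR.integral_one_sub_cos_le l)
        rwa [min_eq_right hsq] at this
      have h3 : |(Ψ l).im| ≤ |l| ^ 3 * W l * 2 := by
        refine (HW l hl).trans ?_
        have := hW0 l
        gcongr
        exact Hδ l hlδ
      have h4 : |Real.sin (l * x)| ≤ |l| * |x| := by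
        rw [← abs_mul]
        exact Real.abs_sin_le_abs
      have hl0 : 0 < |l| := abs_pos.2 hl
      have hl2 : 0 < l ^ 2 := by positivity
      -- The powers of `l` balance: one from the sine and three from `Im Ψ`, against four from `|Ψ|²
      -- ≥ c²l⁴`, leaving the integrable `W`.
      calc |Real.sin (l * x)| * |(((q : ℂ) + Ψ l)⁻¹).im|
          ≤ |l| * |x| * (|l| ^ 3 * W l * 2 / (c * l ^ 2) ^ 2) := by
            refine mul_le_mul h4 (h1.trans ?_) (abs_nonneg _) (by positivity)
            exact div_le_div₀ (mul_nonneg (mul_nonneg (by positivity) (hW0 l)) zero_le_two) h3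
              (by positivity) (by gcongr)
        _ = 2 * |x| / c ^ 2 * W l := by
            rw [← sq_abs l]
            field_simp
    · refine le_add_of_nonneg_of_le hw ?_
      refine le_trans ?_ (inv_norm_le hδ hlδ)
      have h2 : |(((q : ℂ) + Ψ l)⁻¹).im| ≤ ‖Ψ l‖⁻¹ := by
        refine (Complex.abs_im_le_norm _).trans ?_
        rw [norm_inv]
        exact inv_anti₀ h0 (hR.norm_le_norm_add hq l)
      exact (mul_le_of_le_one_left (abs_nonneg _) (Real.abs_sin_le_one _)).trans h2

theorem measurable_diff (hR : IsResolventFamily Ψ r) (q x : ℝ) : Measurable fun l : ℝ =>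
    ((1 - Complex.exp (Complex.I * l * x)) / ((q : ℂ) + Ψ l)).re := by
  have := hR.continuous_exponent.measurable
  exact Complex.measurable_re.comp (by fun_prop)

theorem integrable_limit (hR : IsResolventFamily Ψ r)
    (hfin : Integrable fun x => x ^ 2 * r 1 x) (hμ : ∫ x, x * r 1 x = 0) (x : ℝ) :
    Integrable fun l : ℝ => ((1 - Complex.exp (Complex.I * l * x)) / Ψ l).re := by
  obtain ⟨b, hb, H⟩ := hR.exists_bound hfin hμ x
  have hm := hR.measurable_diff 0 x
  simp only [Complex.ofReal_zero, zero_add] at hm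
  refine hb.mono' hm.aestronglyMeasurable ?_
  filter_upwards [compl_mem_ae_iff.2 (measure_singleton (0 : ℝ))] with l hl
  simpa using H 0 le_rfl l hl

theorem tendsto_diff_of_first_moment (hR : IsResolventFamily Ψ r)
    (hfin : Integrable fun x => x ^ 2 * r 1 x) (hμ : ∫ x, x * r 1 x = 0) (x : ℝ) :
    Tendsto (fun q => resolventDiff r q x) (𝓝[>] 0) (𝓝 ((1 / (2 * Real.pi)) *
      ∫ l : ℝ, ((1 - Complex.exp (Complex.I * l * x)) / Ψ l).re)) := by
  obtain ⟨b, hb, H⟩ := hR.exists_bound hfin hμ x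
  have h1 : Tendsto (fun q : ℝ => (1 / (2 * Real.pi)) * ∫ l : ℝ,
      ((1 - Complex.exp (Complex.I * l * x)) / ((q : ℂ) + Ψ l)).re) (𝓝[>] 0)
      (𝓝 ((1 / (2 * Real.pi)) *
        ∫ l : ℝ, ((1 - Complex.exp (Complex.I * l * x)) / Ψ l).re)) := by
    refine Tendsto.const_mul _ (tendsto_integral_filter_of_dominated_convergence b
      (.of_forall fun q => (hR.measurable_diff q x).aestronglyMeasurable) ?_ hb ?_)
    · filter_upwards [self_mem_nhdsWithin] with q hq
      filter_upwards [compl_mem_ae_iff.2 (measure_singleton (0 : ℝ))] with l hl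
      exact H q (le_of_lt hq) l hl
    · filter_upwards [compl_mem_ae_iff.2 (measure_singleton (0 : ℝ))] with l hl
      have hne : (((0 : ℝ) : ℂ) + Ψ l) ≠ 0 := by
        simpa using hR.norm_exponent_pos hl
      have hc : ContinuousAt (fun q : ℝ =>
          ((1 - Complex.exp (Complex.I * l * x)) / ((q : ℂ) + Ψ l)).re) 0 :=
        Complex.continuous_re.continuousAt.comp
          (continuousAt_const.div (by fun_prop) hne)
      have := hc.tendsto.mono_left (nhdsWithin_le_nhds (s := Ioi 0))
      simpa using this
  refine h1.congr' ?_
  filter_upwards [self_mem_nhdsWithin] with q hq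
  exact (hR.diff_eq hq x).symm

/-- The integrand is even, since `Ψ(-l)` is the conjugate of `Ψ(l)`. -/
theorem integral_limit_eq (hR : IsResolventFamily Ψ r) (x : ℝ) :
    ∫ l : ℝ, ((1 - Complex.exp (Complex.I * l * x)) / Ψ l).re =
      2 * ∫ l in Ioi (0 : ℝ), ((1 - Complex.exp (Complex.I * l * x)) / Ψ l).re := by
  rw [← integral_comp_abs (f := fun l : ℝ => ((1 - Complex.exp (Complex.I * l * x)) / Ψ l).re)]
  refine integral_congr_ae (.of_forall fun l => ?_)
  simp only
  rcases le_total 0 l with hl | hl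
  · rw [abs_of_nonneg hl]
  · rw [abs_of_nonpos hl, hR.exponent_neg, ← Complex.conj_re]
    congr 1
    rw [map_div₀, map_sub, map_one, ← Complex.exp_conj]
    simp

end IsResolventFamily

/-! ### Consequences of recurrence and of a finite second moment of `X_1`. -/

section Levy

variable {Ω : Type*} [MeasurableSpace Ω] {X : ℝ≥0 → Ω → ℝ} {P : Measure Ω}

/-- If `r_q(0) ≤ C` for all `q`, then `r_q ≤ C` everywhere, since `r_q` is maximal at `0`. The
discounted occupation times of `(-1, 1)` are then bounded, and monotone convergence along `q =
1/(n+1)` contradicts recurrence. -/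
theorem IsLevyProcess.exists_lt_inverseResolvent_zero [IsProbabilityMeasure P]
    (hX : IsLevyProcess X P) (hA : ConditionA X P) (hrec : IsRecurrentProcess X P) (C : ℝ) :
    ∃ q, 0 < q ∧ C < inverseResolvent (charExponent X P) q 0 := by
  by_contra! hcon
  have hR := hX.isResolventFamily hA
  set s : Set ℝ := {y : ℝ | |y - 0| < 1} with hs_def
  have hs : MeasurableSet s := measurableSet_lt (by fun_prop) measurable_const
  set f : ℝ → ℝ≥0∞ := s.indicator fun _ => 1 with hf_def
  have hf : Measurable f := measurable_const.indicator hs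
  have hm := hX.measurable_uncurry
  have hmf : Measurable fun z : Ω × ℝ => f (X z.2.toNNReal z.1) := hf.comp hm
  have hmn : ∀ n : ℕ, Measurable fun z : Ω × ℝ =>
      ENNReal.ofReal (Real.exp (-(1 / ((n : ℝ) + 1)) * z.2)) * f (X z.2.toNNReal z.1) := by
    intro n
    have h1 : Measurable fun z : Ω × ℝ => Real.exp (-(1 / ((n : ℝ) + 1)) * z.2) := by fun_prop
    exact h1.ennreal_ofReal.mul hmf
  have hbound : ∀ n : ℕ, ∫⁻ z : Ω × ℝ, ENNReal.ofReal (Real.exp (-(1 / ((n : ℝ) + 1)) * z.2)) *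
      f (X z.2.toNNReal z.1) ∂(P.prod (volume.restrict (Ici 0))) ≤
      ENNReal.ofReal C * volume s := by
    intro n
    have hq : 0 < 1 / ((n : ℝ) + 1) := by positivity
    rw [lintegral_prod _ (hmn n).aemeasurable]
    rw [← (hX.isResolventDensity_inverseResolvent hA hq).lintegral_eq f hf,
      ← lintegral_indicator_const hs]
    refine lintegral_mono fun x => ?_
    by_cases hx : x ∈ s
    · simp only [hf_def, indicator_of_mem hx, one_mul]
      exact ENNReal.ofReal_le_ofReal ((hR.le_zero hq x).trans (hcon _ hq))
    · simp [hf_def, hx]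
  have hlim : Tendsto (fun n : ℕ => ∫⁻ z : Ω × ℝ,
      ENNReal.ofReal (Real.exp (-(1 / ((n : ℝ) + 1)) * z.2)) * f (X z.2.toNNReal z.1)
        ∂(P.prod (volume.restrict (Ici 0)))) atTop
      (𝓝 (∫⁻ z : Ω × ℝ, f (X z.2.toNNReal z.1) ∂(P.prod (volume.restrict (Ici 0))))) := by
    have hae : ∀ᵐ z : Ω × ℝ ∂(P.prod (volume.restrict (Ici 0))), 0 ≤ z.2 := by
      have h1 : ∀ᵐ t : ℝ ∂(volume.restrict (Ici 0)), 0 ≤ t := ae_restrict_mem measurableSet_Ici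
      exact Measure.quasiMeasurePreserving_snd.ae h1
    refine lintegral_tendsto_of_tendsto_of_monotone (fun n => (hmn n).aemeasurable) ?_ ?_
    · filter_upwards [hae] with z hz
      intro m n hmn
      simp only
      gcongr
    · refine .of_forall fun z => ?_
      have h1 : Tendsto (fun n : ℕ => Real.exp (-(1 / ((n : ℝ) + 1)) * z.2)) atTop (𝓝 1) := by
        have h2 : Tendsto (fun n : ℕ => -(1 / ((n : ℝ) + 1)) * z.2) atTop (𝓝 0) := by
          simpa using (tendsto_one_div_add_atTop_nhds_zero_nat (𝕜 := ℝ)).neg.mul_const z.2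
        simpa using! (Real.continuous_exp.tendsto 0).comp h2
      have h2 := ENNReal.Tendsto.mul_const (b := f (X z.2.toNNReal z.1))
        ((ENNReal.continuous_ofReal.tendsto 1).comp h1) (Or.inl (by simp))
      simpa using! h2
  have h1 := le_of_tendsto' hlim hbound
  rw [lintegral_prod _ hmf.aemeasurable] at h1
  have h2 : ENNReal.ofReal C * volume s < ∞ := by
    refine ENNReal.mul_lt_top ENNReal.ofReal_lt_top ?_
    have : s = Ioo (-1) 1 := by
      ext y
      simp [hs_def, abs_lt]
    rw [this]
    simp
  exact (h1.trans_lt h2).ne (hrec 0 1 one_pos)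

theorem IsLevyProcess.exists_exponent_le [IsProbabilityMeasure P] (hX : IsLevyProcess X P)
    (hm2 : secondMoment X P < ∞) :
    ∃ C δ, 0 < δ ∧ ∀ l, |l| ≤ δ →
      (charExponent X P l).re + ‖charExponent X P l‖ ^ 2 ≤ C * l ^ 2 := by
  have hmX := hX.measurable 1
  have hsq : Integrable (fun ω => X 1 ω ^ 2) P := by
    refine ⟨by fun_prop, ?_⟩
    rw [hasFiniteIntegral_iff_ofReal (.of_forall fun ω => sq_nonneg _)]
    exact hm2
  have habs : Integrable (fun ω => |X 1 ω|) P := by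
    refine (hsq.add (integrable_const 1)).mono' (by fun_prop) (.of_forall fun ω => ?_)
    rw [Real.norm_eq_abs, abs_abs, Pi.add_apply, ← sq_abs]
    nlinarith [sq_nonneg (|X 1 ω| - 1), abs_nonneg (X 1 ω)]
  set E := ∫ ω, |X 1 ω| ∂P with hE
  set S := ∫ ω, X 1 ω ^ 2 ∂P with hS
  have hexp : ∀ l : ℝ, Integrable (fun ω => Complex.exp (Complex.I * l * X 1 ω)) P := by
    intro l
    refine Integrable.of_bound (C := 1) (Measurable.aestronglyMeasurable (by fun_prop))
      (.of_forall fun ω => ?_)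
    rw [Complex.norm_exp]
    simp
  have hch : ∀ l : ℝ, ∫ ω, Complex.exp (Complex.I * l * X 1 ω) ∂P =
      Complex.exp (-charExponent X P l) := by
    intro l
    rw [hX.integral_exp_eq l 1]
    simp
  have h1 : ∀ l : ℝ, ‖Complex.exp (-charExponent X P l) - 1‖ ≤ |l| * E := by
    intro l
    have e : Complex.exp (-charExponent X P l) - 1 =
        ∫ ω, (Complex.exp (Complex.I * l * X 1 ω) - 1) ∂P := by
      rw [integral_sub (hexp l) (integrable_const _), hch]
      simp
    rw [e, hE, ← integral_const_mul]
    refine norm_integral_le_of_norm_le (habs.const_mul _) (.of_forall fun ω => ?_)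
    rw [← abs_mul, ← Real.norm_eq_abs]
    have := Real.norm_exp_I_mul_ofReal_sub_one_le (x := l * X 1 ω)
    push_cast at this
    rwa [← mul_assoc] at this
  have h2 : ∀ l : ℝ, 1 - (Complex.exp (-charExponent X P l)).re ≤ S / 2 * l ^ 2 := by
    intro l
    have e : 1 - (Complex.exp (-charExponent X P l)).re = ∫ ω, (1 - Real.cos (l * X 1 ω)) ∂P := by
      have e1 : (∫ ω, Complex.exp (Complex.I * l * X 1 ω) ∂P).re =
          ∫ ω, (Complex.exp (Complex.I * l * X 1 ω)).re ∂P := (integral_re (hexp l)).symm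
      have e2 : ∀ ω, (Complex.exp (Complex.I * l * X 1 ω)).re = Real.cos (l * X 1 ω) := by
        intro ω
        rw [Complex.exp_re]
        simp
      have e3 : Integrable (fun ω => Real.cos (l * X 1 ω)) P := 
        Integrable.of_bound (C := 1) (Measurable.aestronglyMeasurable (by fun_prop))
          (.of_forall fun ω => Real.abs_cos_le_one _)
      rw [integral_sub (integrable_const _) e3, ← hch, e1]
      simp [e2]
    rw [e, hS, div_mul_eq_mul_div, ← integral_mul_const, ← integral_div]
    refine integral_mono_of_nonneg (.of_forall fun ω => one_sub_cos_nonneg _)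
      ((hsq.mul_const _).div_const _) (.of_forall fun ω => ?_)
    refine (one_sub_cos_le_sq _).trans_eq ?_
    ring
  have hc := hX.continuous_charExponent
  have h0 : charExponent X P 0 = 0 := (hX.eq_charExponent 0 0 fun t => by simp).symm
  obtain ⟨ε, hε, H⟩ := Metric.eventually_nhds_iff.1 (hc.norm.continuousAt (x := 0) |>.eventually
    (gt_mem_nhds (show ‖charExponent X P 0‖ < 1 / 2 by rw [h0]; simp)))
  -- From `|e^{-ψ} - 1 + ψ| ≤ |ψ|²` and `|ψ| < 1/2` follow `|ψ| ≤ 2E|l|` and `Re ψ ≤ S l²/2 + |ψ|²`;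
  -- adding another `|ψ|²` gives the constant.
  refine ⟨S / 2 + 2 * (2 * E) ^ 2, ε / 2, by positivity, fun l hl => ?_⟩
  set ψ := charExponent X P l with hψ
  have hψ2 : ‖ψ‖ < 1 / 2 := H (by rw [Real.dist_eq, sub_zero]; linarith)
  have h3 := Complex.norm_exp_sub_one_sub_id_le (x := -ψ) (by rw [norm_neg]; linarith)
  rw [norm_neg, sub_neg_eq_add] at h3
  have h4 : ‖ψ‖ ≤ 2 * E * |l| := by
    have h5 : ‖ψ‖ ≤ ‖Complex.exp (-ψ) - 1 + ψ‖ + ‖Complex.exp (-ψ) - 1‖ := by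
      have := norm_sub_le (Complex.exp (-ψ) - 1 + ψ) (Complex.exp (-ψ) - 1)
      rwa [add_sub_cancel_left] at this
    have h6 := h1 l
    nlinarith [norm_nonneg ψ]
  have h5 : ψ.re ≤ S / 2 * l ^ 2 + ‖ψ‖ ^ 2 := by
    have h6 := (Complex.re_le_norm (Complex.exp (-ψ) - 1 + ψ)).trans h3
    have h7 := h2 l
    simp only [Complex.add_re, Complex.sub_re, Complex.one_re] at h6
    linarith
  have h6 : ‖ψ‖ ^ 2 ≤ (2 * E) ^ 2 * l ^ 2 := by
    rw [← sq_abs l, ← mul_pow]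
    gcongr
  nlinarith

/-- Transfers the second moment from `X_1` to `r_1`: `∫ (1 - cos lx) r_1 = (Re Ψ + |Ψ|²)/|1+Ψ|² ≤ C
l²` near `0`, which caps every truncated second moment at `Cπ²/2`. -/
theorem IsLevyProcess.integrable_sq_mul [IsProbabilityMeasure P] (hX : IsLevyProcess X P)
    (hA : ConditionA X P) (hm2 : secondMoment X P < ∞) :
    Integrable fun x => x ^ 2 * inverseResolvent (charExponent X P) 1 x := by
  have hR := hX.isResolventFamily hA
  obtain ⟨C, δ, hδ, H⟩ := hX.exists_exponent_le hm2
  by_contra hinf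
  obtain ⟨N, hN, hlt⟩ := hR.exists_lt_setIntegral hinf (C * Real.pi ^ 2 / 2)
  set l := min δ (1 / N) with hl
  have hl0 : 0 < l := by positivity
  have h1 := hR.sq_mul_setIntegral_le (N := N) (l := l) (by
    rw [abs_of_pos hl0]
    calc l * N ≤ 1 / N * N := by gcongr; exact min_le_right _ _
      _ = 1 := by field_simp)
  have h2 := H l (by rw [abs_of_pos hl0]; exact min_le_left _ _)
  have h3 : ∫ x, (1 - Real.cos (l * x)) * inverseResolvent (charExponent X P) 1 x ≤
      (charExponent X P l).re + ‖charExponent X P l‖ ^ 2 := by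
    have hp := hR.normSq_one_add_pos l
    have hre := hR.re_nonneg l
    rw [hR.integral_one_sub_cos, Complex.inv_re, ← Complex.normSq_eq_norm_sq]
    have h4 : 1 ≤ Complex.normSq (1 + charExponent X P l) := by
      rw [Complex.normSq_eq_norm_sq]
      nlinarith [hR.one_le_norm_add l]
    have h5 : 1 - (1 + charExponent X P l).re / Complex.normSq (1 + charExponent X P l) =
        ((charExponent X P l).re + Complex.normSq (charExponent X P l)) /
          Complex.normSq (1 + charExponent X P l) := by
      rw [eq_div_iff hp.ne', sub_mul, div_mul_cancel₀ _ hp.ne', one_mul, Complex.normSq_apply,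
        Complex.normSq_apply]
      simp
      ring
    rw [h5]
    exact div_le_self (add_nonneg hre (Complex.normSq_nonneg _)) h4
  have hpi := Real.pi_pos
  have h6 : 2 / Real.pi ^ 2 * l ^ 2 * (C * Real.pi ^ 2 / 2) <
      2 / Real.pi ^ 2 * l ^ 2 * ∫ x in Icc (-N) N,
        x ^ 2 * inverseResolvent (charExponent X P) 1 x :=
    mul_lt_mul_of_pos_left hlt (by positivity)
  have h7 : 2 / Real.pi ^ 2 * l ^ 2 * (C * Real.pi ^ 2 / 2) = C * l ^ 2 := by
    field_simp
  linarith

end Levy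

/-! ### Uniform convergence on compacts and the conclusion. -/

namespace IsResolventFamily

variable {Ψ : ℝ → ℂ} {r : ℝ → ℝ → ℝ}

theorem isSubseqLimit_of_tendsto {H : ℝ → ℝ}
    (hH : ∀ x, Tendsto (fun q => resolventDiff r q x) (𝓝[>] 0) (𝓝 (H x))) :
    IsSubseqLimit r H := by
  have h1 : Tendsto (fun n : ℕ => 1 / ((n : ℝ) + 1)) atTop (𝓝 0) :=
    tendsto_one_div_add_atTop_nhds_zero_nat
  refine ⟨fun n => 1 / ((n : ℝ) + 1), fun n => by positivity, h1, fun x => (hH x).comp ?_⟩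
  exact tendsto_nhdsWithin_iff.2 ⟨h1, .of_forall fun n => by rw [mem_Ioi]; positivity⟩

/-- The modulus `ω` is shared by the limit and all `h_q`, so convergence at the centre of a small
ball controls the whole ball. -/
theorem tendstoUniformlyOn (hR : IsResolventFamily Ψ r) {H : ℝ → ℝ}
    (hH : ∀ x, Tendsto (fun q => resolventDiff r q x) (𝓝[>] 0) (𝓝 (H x))) {K : Set ℝ}
    (hK : IsCompact K) : TendstoUniformlyOn (resolventDiff r) H (𝓝[>] 0) K := by
  have hlim := isSubseqLimit_of_tendsto hH
  rw [← tendstoLocallyUniformlyOn_iff_tendstoUniformlyOn_of_compact hK]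
  refine Metric.tendstoLocallyUniformlyOn_iff.2 fun ε hε x _ => ?_
  obtain ⟨δ, hδ, h⟩ := Metric.eventually_nhds_iff.1
    (hR.tendsto_symmMajorant.eventually (gt_mem_nhds (show (0 : ℝ) < ε / 3 by positivity)))
  refine ⟨Metric.ball x δ, mem_nhdsWithin_of_mem_nhds (Metric.ball_mem_nhds x hδ), ?_⟩
  filter_upwards [self_mem_nhdsWithin, Metric.tendsto_nhds.1 (hH x) (ε / 3) (by positivity)]
    with q hq h1 y hy
  have hω : symmMajorant Ψ (y - x) < ε / 3 := h (by
    rwa [Real.dist_eq, sub_zero, ← Real.dist_eq])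
  have h2 := (hlim.abs_sub_le hR y x).trans_lt hω
  have h3 := (hR.abs_diff_sub_le hq y x).trans_lt hω
  rw [Real.dist_eq] at h1 ⊢
  rw [abs_lt] at h1 h2 h3 ⊢
  constructor <;> linarith [h1.1, h1.2, h2.1, h2.2, h3.1, h3.2]

end IsResolventFamily

theorem mainTheorem1 {Ω : Type*} [MeasurableSpace Ω] (P : Measure Ω) [IsProbabilityMeasure P]
    (X : ℝ≥0 → Ω → ℝ) (hX : IsLevyProcess X P) (hrec : IsRecurrentProcess X P)
    (hA : ConditionA X P) :
    (∀ q : ℝ, 0 < q → IsResolventDensity X P q (resolventDensity X P q)) ∧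
    ∃ h : ℝ → ℝ,
      (∀ x : ℝ, Tendsto (fun q => hq X P q x) (𝓝[>] 0) (𝓝 (h x))) ∧
      (secondMoment X P < ∞ → ∀ x : ℝ,
        IntegrableOn
          (fun lam : ℝ =>
            ((1 - Complex.exp (Complex.I * lam * x)) / charExponent X P lam).re) (Ioi 0) ∧
        h x = (1 / Real.pi) * ∫ lam in Ioi (0 : ℝ),
          ((1 - Complex.exp (Complex.I * lam * x)) / charExponent X P lam).re) ∧
      (∀ K : Set ℝ, IsCompact K → TendstoUniformlyOn (hq X P) h (𝓝[>] 0) K) ∧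
      Continuous h ∧
      (∀ x y : ℝ, h (x + y) ≤ h x + h y) := by
  have hR := hX.isResolventFamily hA
  set r := inverseResolvent (charExponent X P) with hr
  have hhq : ∀ q : ℝ, 0 < q → hq X P q = resolventDiff r q := by
    intro q hq0
    ext x
    rw [hq, hX.resolventDensity_eq hA hq0, resolventDiff]
  have hlim : ∃ h : ℝ → ℝ, (∀ x, Tendsto (fun q => resolventDiff r q x) (𝓝[>] 0) (𝓝 (h x))) ∧
      (secondMoment X P < ∞ → ∀ x : ℝ,
        IntegrableOn
          (fun lam : ℝ =>
            ((1 - Complex.exp (Complex.I * lam * x)) / charExponent X P lam).re) (Ioi 0) ∧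
        h x = (1 / Real.pi) * ∫ lam in Ioi (0 : ℝ),
          ((1 - Complex.exp (Complex.I * lam * x)) / charExponent X P lam).re) := by
    -- The split is on the second moment of `r_1`, not on `m²`; in the second case `m² < ∞` is
    -- contradictory, so the formula is vacuous there.
    by_cases hfin : Integrable fun x => x ^ 2 * r 1 x
    · have hμ := hR.first_moment_eq_zero hfin (hX.exists_lt_inverseResolvent_zero hA hrec)
      refine ⟨_, hR.tendsto_diff_of_first_moment hfin hμ, fun _ x =>
        ⟨(hR.integrable_limit hfin hμ x).integrableOn, ?_⟩⟩
      rw [hR.integral_limit_eq, ← mul_assoc]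
      congr 1
      field_simp
    · obtain ⟨H, hH⟩ := hR.exists_limit_of_not_integrable hfin
      exact ⟨H, hH, fun hm2 => absurd (hX.integrable_sq_mul hA hm2) hfin⟩
  obtain ⟨h, hh, hformula⟩ := hlim
  refine ⟨fun q hq0 => ?_, h, fun x => ?_, hformula, fun K hK => ?_,
    ((IsResolventFamily.isSubseqLimit_of_tendsto hh).uniformContinuous hR).continuous,
    fun x y => ?_⟩
  · rw [hX.resolventDensity_eq hA hq0]
    exact hX.isResolventDensity_inverseResolvent hA hq0
  · refine (hh x).congr' ?_
    filter_upwards [self_mem_nhdsWithin] with q hq0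
    rw [hhq q hq0]
  · refine (hR.tendstoUniformlyOn hh hK).congr ?_
    filter_upwards [self_mem_nhdsWithin] with q hq0 x _
    rw [hhq q hq0]
  · refine le_of_tendsto_of_tendsto (hh (x + y)) ((hh x).add (hh y)) ?_
    filter_upwards [self_mem_nhdsWithin] with q hq0
    exact hR.diff_add_le hq0 x y
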